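/- Let $k$ be a field of arbitrary characteristic, and let \[ R=k[x,y,a,b]/(bx,\;xy,\;ax-by,\;x^2-y^2),\qquad R'=k[x,y]/(x^2-y^2,\;xy), \] with the standard gradings; put $U=(a,b)\subseteq R$ and $R_+=\bigoplus_{n\ge1}R_n$. A graded $k$-algebra $A$ is called Koszul if the $A$-module $A/A_+$ has a linear free resolution, i.e. a graded free resolution $\cdots\to A(-2)^{\beta_2}\to A(-1)^{\beta_1}\to A^{\beta_0}\to A/A_+\to 0$. A matrix $N$ over $R$ with linear entries has a minimal quadratic syzygy if there is $s\in\ker N$ with all coordinates in $R_2$ and $s\notin R_+\ker N$. Then: (1) $R'$ is an algebra retract of $R$: there are $k$-algebra maps $\varphi:R\to R'$ with $x\mapsto x$, $y\mapsto y$, $a,b\mapsto 0$, and $\sigma:R'\to R$ with $x\mapsto x$, $y\mapsto y$, such that $\varphi\circ\sigma=\mathrm{id}_{R'}$; moreover $\ker\varphi=U$, so $R'\cong R/U$. (2) The first three steps of the minimal graded free resolution of the ideal $U$ over $R$ are \[ R(-4)^{11}\xrightarrow{\partial_3}R(-3)^{6}\xrightarrow{\partial_2}R(-2)^{3}\xrightarrow{\partial_1}R(-1)^{2}\xrightarrow{(a\;b)}U\to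 0, \] where \[ \partial_1=\left(\begin{array}{ccc} x & 0 & b \\ -y & x & -a \end{array}\right) \] \[ \partial_2=\left(\begin{array}{cccccc} y & 0 & b & 0 & - b & -a \\ x & y & a & b & 0 & 0 \\ 0 & 0 & 0 & 0 & x & y \end{array}\right) \] \[ \partial_3=\left(\begin{array}{ccccccccccc} x & 0 & 0 & -b & 0 & 0 & b & b & a & 0 & 0 \\ -y & x & -b & -a & 0 & -b & 0 & 0 & -b & 0 & 0 \\ 0 & 0 & x & y & 0 & 0 & 0 & 0 & 0 & 0 & b \\ 0 & 0 & 0 & 0 & x & y & 0 & 0 & 0 & 0 & -a \\ 0 & 0 & 0 & 0 & 0 & 0 & y & 0 & -x & a & b \\ 0 & 0 & 0 & 0 & 0 & 0 & 0 & x & y & -b & 0 \end{array}\right) \] That is, $a,b$ minimally generate $U$, the columns of $\partial_1$ minimally generate $\ker\,(a\;b)$, and the columns of $\partial_{i+1}$ minimally generate $\ker\partial_i$ for $i=1,2$. (3) If $\operatorname{char}k=2$, then $\partial_3$ has a minimal quadratic syzygy (so a quadratic syzygy appears at step 4). (4) If $\operatorname{char}k\ne2$, then $\ker\partial_3$ is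 minimally generated by the columns of $\partial_4:R(-5)^{20}\to R(-4)^{11}$, \[ \partial_4=\left(\begin{array}{cccccccccccccccccccc} y & 0 & b & 0 & -b & -b & -a & 0 & 0 & -b & 0 & 0 & 0 & 0 & 0 & 0 & 0 & 0 & 0 & 0 \\ x & y & a & b & 0 & 0 & 0 & 0 & 0 & 0 & 0 & 0 & 0 & 0 & 0 & 0 & 0 & 0 & 0 & 0 \\ 0 & 0 & 0 & 0 & y & 0 & -x & 0 & 0 & 0 & 0 & 0 & 0 & -b & -a & -b & a & 0 & 0 & 0 \\ 0 & 0 & 0 & 0 & 0 & x & y & 0 & 0 & 0 & 0 & 0 & 0 & 0 & b & 0 & -b & 0 & 0 & -b \\ 0 & 0 & 0 & 0 & 0 & 0 & 0 & y & 0 & -x & 0 & 0 & b & -a & 0 & 0 & 0 & 0 & a & 0 \\ 0 & 0 & 0 & 0 & 0 & 0 & 0 & 0 & x & y & 0 & 0 & 0 & b & 0 & 0 & 0 & 0 & 0 & a \\ 0 & 0 & 0 & 0 & 0 & 0 & 0 & 0 & 0 & 0 & x & y & 0 & 0 & 0 & 0 & -b & -a & 0 & -b \\ 0 & 0 & 0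 & 0 & 0 & 0 & 2y & 0 & 0 & 0 & 0 & -2y & 0 & 0 & b & -a & 0 & a & 0 & 0 \\ 0 & 0 & 0 & 0 & 0 & 0 & 0 & 0 & 0 & 0 & 0 & x & 0 & 0 & 0 & b & 0 & 0 & 0 & 0 \\ 0 & 0 & 0 & 0 & 0 & 0 & 0 & 0 & 0 & 0 & 0 & 0 & 0 & 0 & 0 & 0 & x & y & 0 & 0 \\ 0 & 0 & 0 & 0 & 0 & 0 & 0 & 0 & 0 &0 & 0 & 0 & 0 & 0 & 0 & 0 & 0 & 0 & x & y \end{array}\right) \] and $\partial_4$ has a minimal quadratic syzygy (so a quadratic syzygy appears at step 5). (5) In every characteristic, $R$ is not Koszul. -/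

import Mathlib

open scoped DirectSum

/-! ### Graded quotients of polynomial rings -/

/-- The degree-`n` part of `k[X_i : i ∈ τ] / I`: the image of the forms of degree `n`. -/
noncomputable def stdGrading {τ k : Type*} [Field k] (I : Ideal (MvPolynomial τ k)) (n : ℕ) :
    Submodule k (MvPolynomial τ k ⧸ I) :=
  (MvPolynomial.homogeneousSubmodule τ k n).map (Ideal.Quotient.mkₐ k I).toLinearMap

theorem mk_mem_stdGrading {τ k : Type*} [Field k] (I : Ideal (MvPolynomial τ k)) {n : ℕ}
    {p : MvPolynomial τ k} (hp : p.IsHomogeneous n) :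
    Ideal.Quotient.mk I p ∈ stdGrading I n :=
  ⟨p, hp, rfl⟩

instance stdGrading.gradedMonoid {τ k : Type*} [Field k] (I : Ideal (MvPolynomial τ k)) :
    SetLike.GradedMonoid (stdGrading I) where
  one_mem := ⟨1, MvPolynomial.isHomogeneous_one τ k, rfl⟩
  mul_mem := by
    rintro i j _ _ ⟨p, hp, rfl⟩ ⟨q, hq, rfl⟩
    exact ⟨p * q, MvPolynomial.IsHomogeneous.mul hp hq,
      map_mul (Ideal.Quotient.mk I) p q⟩

/-- The algebra map sending each variable to its class in degree one. -/
noncomputable def stdDecompAux {τ k : Type*} [Field k] (I : Ideal (MvPolynomial τ k)) :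
    MvPolynomial τ k →ₐ[k] ⨁ n, stdGrading I n :=
  MvPolynomial.aeval fun i => DirectSum.of (fun n => stdGrading I n) 1
    ⟨Ideal.Quotient.mk I (MvPolynomial.X i),
      mk_mem_stdGrading I (MvPolynomial.isHomogeneous_X k i)⟩

theorem stdDecompAux_coe {τ k : Type*} [Field k] (I : Ideal (MvPolynomial τ k))
    (p : MvPolynomial τ k) :
    DirectSum.coeAlgHom (stdGrading I) (stdDecompAux I p) = Ideal.Quotient.mk I p := by
  have h : (DirectSum.coeAlgHom (stdGrading I)).comp (stdDecompAux I)
      = Ideal.Quotient.mkₐ k I := by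
    ext i
    simp [stdDecompAux]
  exact AlgHom.congr_fun h p

theorem stdDecompAux_monomial {τ k : Type*} [Field k] (I : Ideal (MvPolynomial τ k))
    (d : τ →₀ ℕ) (c : k) :
    ∃ z : stdGrading I d.degree, stdDecompAux I (MvPolynomial.monomial d c)
      = DirectSum.of (fun n => stdGrading I n) d.degree z := by
  induction d using Finsupp.induction_linear generalizing c with
  | zero =>
    refine ⟨⟨algebraMap k _ c, ?_⟩, ?_⟩
    · exact ⟨MvPolynomial.C c, by simp, rfl⟩
    · change stdDecompAux I (algebraMap k _ c) = _
      rw [AlgHom.commutes]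
      rfl
  | add d e hd he =>
    obtain ⟨z, hz⟩ := hd c
    obtain ⟨w, hw⟩ := he 1
    have h : MvPolynomial.monomial (d + e) c
        = MvPolynomial.monomial d c * MvPolynomial.monomial e (1 : k) := by
      rw [MvPolynomial.monomial_mul, mul_one]
    rw [h, map_mul, hz, hw, DirectSum.of_mul_of, map_add]
    exact ⟨_, rfl⟩
  | single i m =>
    have h : MvPolynomial.monomial (Finsupp.single i m) c
        = c • (MvPolynomial.X i : MvPolynomial τ k) ^ m := by
      rw [MvPolynomial.X_pow_eq_monomial, MvPolynomial.smul_monomial, smul_eq_mul, mul_one]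
    have h2 : (Finsupp.single i m).degree = m • 1 := by simp
    rw [h, map_smul, map_pow, h2]
    simp only [stdDecompAux, MvPolynomial.aeval_X]
    rw [DirectSum.ofPow]
    have key : ∀ (j : ℕ) (z : stdGrading I j), ∃ w : stdGrading I j,
        c • DirectSum.of (fun n => stdGrading I n) j z
          = DirectSum.of (fun n => stdGrading I n) j w := fun j z =>
      ⟨c • z, by rw [← DirectSum.lof_eq_of k, ← DirectSum.lof_eq_of k, map_smul]⟩
    exact key _ _

theorem stdDecompAux_homogeneous {τ k : Type*} [Field k] (I : Ideal (MvPolynomial τ k)) {n : ℕ}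
    {p : MvPolynomial τ k} (hp : p.IsHomogeneous n) :
    stdDecompAux I p = DirectSum.of (fun n => stdGrading I n) n
      ⟨Ideal.Quotient.mk I p, mk_mem_stdGrading I hp⟩ := by
  have h : ∃ z : stdGrading I n,
      stdDecompAux I p = DirectSum.of (fun n => stdGrading I n) n z := by
    rw [p.as_sum, map_sum]
    have hm : ∀ d ∈ p.support, ∃ z : stdGrading I n,
        stdDecompAux I (MvPolynomial.monomial d (p.coeff d))
          = DirectSum.of (fun n => stdGrading I n) n z := by
      intro d hd
      have := hp.degree_eq_sum_deg_support hd
      obtain ⟨z, hz⟩ := stdDecompAux_monomial I d (p.coeff d)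
      have e : d.degree = n := by rw [this]; rfl
      subst e
      exact ⟨z, hz⟩
    choose! z hz using hm
    exact ⟨∑ d ∈ p.support, z d, by rw [map_sum]; exact Finset.sum_congr rfl hz⟩
  obtain ⟨z, hz⟩ := h
  rw [hz]
  congr 1
  apply Subtype.ext
  have := stdDecompAux_coe I p
  rw [hz, DirectSum.coeAlgHom_of] at this
  exact this

/-- A quotient of a polynomial ring by homogeneous relations is graded by `stdGrading`. -/
noncomputable abbrev stdGradedAlgebra {τ k : Type*} [Field k] (s : Set (MvPolynomial τ k))
    (hs : ∀ p ∈ s, ∃ n, p.IsHomogeneous n) : GradedAlgebra (stdGrading (Ideal.span s)) :=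
  GradedAlgebra.ofAlgHom (stdGrading (Ideal.span s))
    (Ideal.Quotient.liftₐ (Ideal.span s) (stdDecompAux (Ideal.span s)) (by
      intro p hp
      have hle : Ideal.span s ≤ RingHom.ker (stdDecompAux (Ideal.span s)) := by
        refine Ideal.span_le.2 fun q hq => ?_
        obtain ⟨n, hn⟩ := hs q hq
        have h0 : Ideal.Quotient.mk (Ideal.span s) q = 0 :=
          Ideal.Quotient.eq_zero_iff_mem.2 (Ideal.subset_span hq)
        change stdDecompAux (Ideal.span s) q = 0
        rw [stdDecompAux_homogeneous _ hn]
        simp only [h0]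
        exact map_zero _
      exact hle hp))
    (by
      apply AlgHom.ext
      intro r
      obtain ⟨p, rfl⟩ := Ideal.Quotient.mk_surjective r
      exact stdDecompAux_coe _ p)
    (by
      rintro i ⟨_, p, hp, rfl⟩
      exact stdDecompAux_homogeneous _ hp)

/-! ### Linear resolutions and Koszul algebras -/

/-- The graded module `M = ⨁ ℳ n` over the graded ring `R = ⨁ 𝒜 n` has a linear free resolution
`⋯ → R(-2)^{β 2} → R(-1)^{β 1} → R^{β 0} → M → 0`: an exact sequence in which the standard basis of
`R^{β 0}` maps into `ℳ 0` and every differential is a matrix of elements of degree one. -/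
def HasLinearResolution {k R M : Type*} [Field k] [CommRing R] [Algebra k R]
    (𝒜 : ℕ → Submodule k R) [AddCommGroup M] [Module R M] [Module k M]
    (ℳ : ℕ → Submodule k M) : Prop :=
  ∃ (β : ℕ → ℕ) (ε : (Fin (β 0) → R) →ₗ[R] M)
    (D : ∀ i, Matrix (Fin (β i)) (Fin (β (i + 1))) R),
    (∀ j, ε (Pi.single j 1) ∈ ℳ 0) ∧
    (∀ i p q, D i p q ∈ 𝒜 1) ∧
    Function.Surjective ε ∧
    LinearMap.range (D 0).mulVecLin = LinearMap.ker ε ∧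
    ∀ i, LinearMap.range (D (i + 1)).mulVecLin = LinearMap.ker (D i).mulVecLin

/-- `R` is Koszul: the `R`-module `R / R₊` has a linear free resolution. -/
def IsKoszulAlgebra {k R : Type*} [Field k] [CommRing R] [Algebra k R]
    (𝒜 : ℕ → Submodule k R) [GradedAlgebra 𝒜] : Prop :=
  HasLinearResolution 𝒜 (M := R ⧸ (HomogeneousIdeal.irrelevant 𝒜).toIdeal)
    fun n => (𝒜 n).map
      (Ideal.Quotient.mkₐ k (HomogeneousIdeal.irrelevant 𝒜).toIdeal).toLinearMap

/-! ### Minimal syzygies -/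

/-- The images under `f` of the standard basis vectors minimally generate `K`. -/
structure IsMinimalCover {k R M : Type*} [Field k] [CommRing R] [Algebra k R]
    (𝒜 : ℕ → Submodule k R) [GradedAlgebra 𝒜] [AddCommGroup M] [Module R M] {n : ℕ}
    (f : (Fin n → R) →ₗ[R] M) (K : Submodule R M) : Prop where
  range_eq : LinearMap.range f = K
  ker_le : LinearMap.ker f ≤
    (HomogeneousIdeal.irrelevant 𝒜).toIdeal • (⊤ : Submodule R (Fin n → R))

/-- The columns of `N` are linear forms in the given basis and minimally generate `K`. -/
structure IsMinimalLinearCover {k R : Type*} [Field k] [CommRing R] [Algebra k R]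
    (𝒜 : ℕ → Submodule k R) [GradedAlgebra 𝒜] {m n : ℕ}
    (N : Matrix (Fin m) (Fin n) R) (K : Submodule R (Fin m → R)) : Prop where
  linear : ∀ i j, N i j ∈ 𝒜 1
  cover : IsMinimalCover 𝒜 N.mulVecLin K

/-- Among the minimal homogeneous generators of the kernel of `N` there is one whose coordinates
are quadratic: an element `s` of `ker N` with coordinates of degree two and `s ∉ R₊ · ker N`. -/
def HasMinimalQuadraticSyzygy {k R : Type*} [Field k] [CommRing R] [Algebra k R]
    (𝒜 : ℕ → Submodule k R) [GradedAlgebra 𝒜] {m n : ℕ}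
    (N : Matrix (Fin m) (Fin n) R) : Prop :=
  ∃ s ∈ LinearMap.ker N.mulVecLin, (∀ j, s j ∈ 𝒜 2) ∧
    s ∉ (HomogeneousIdeal.irrelevant 𝒜).toIdeal • LinearMap.ker N.mulVecLin

/-! ### The algebra, its retract, and the matrices -/

namespace BadAlgebra

open MvPolynomial

/-- The relations `bx, xy, ax - by, x² - y²`; the variables `0, 1, 2, 3` are `x, y, a, b`. -/
noncomputable def relations (k : Type*) [Field k] : Set (MvPolynomial (Fin 4) k) :=
  {X 3 * X 0, X 0 * X 1, X 2 * X 0 - X 3 * X 1, X 0 ^ 2 - X 1 ^ 2}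

theorem relations_homogeneous (k : Type*) [Field k] :
    ∀ p ∈ relations k, ∃ n, p.IsHomogeneous n := by
  have h : ∀ i j : Fin 4, (X i * X j : MvPolynomial (Fin 4) k).IsHomogeneous 2 := fun i j =>
    (isHomogeneous_X k i).mul (isHomogeneous_X k j)
  have h2 : ∀ i : Fin 4, (X i ^ 2 : MvPolynomial (Fin 4) k).IsHomogeneous 2 := fun i =>
    isHomogeneous_X_pow i 2
  rintro p (rfl | rfl | rfl | rfl)
  · exact ⟨2, h _ _⟩
  · exact ⟨2, h _ _⟩
  · exact ⟨2, (h _ _).sub (h _ _)⟩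
  · exact ⟨2, (h2 _).sub (h2 _)⟩

/-- `R = k[x, y, a, b] / (bx, xy, ax - by, x² - y²)`. -/
abbrev R (k : Type*) [Field k] : Type _ := MvPolynomial (Fin 4) k ⧸ Ideal.span (relations k)

/-- The standard grading of `R`. -/
noncomputable abbrev gr (k : Type*) [Field k] : ℕ → Submodule k (R k) :=
  stdGrading (Ideal.span (relations k))

noncomputable instance gradedAlgebra (k : Type*) [Field k] : GradedAlgebra (gr k) :=
  stdGradedAlgebra (relations k) (relations_homogeneous k)

noncomputable def x (k : Type*) [Field k] : R k := Ideal.Quotient.mk _ (X 0)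
noncomputable def y (k : Type*) [Field k] : R k := Ideal.Quotient.mk _ (X 1)
noncomputable def a (k : Type*) [Field k] : R k := Ideal.Quotient.mk _ (X 2)
noncomputable def b (k : Type*) [Field k] : R k := Ideal.Quotient.mk _ (X 3)

/-- `R' = k[x, y] / (x² - y², xy)`. -/
abbrev R' (k : Type*) [Field k] : Type _ :=
  MvPolynomial (Fin 2) k ⧸
    Ideal.span ({X 0 ^ 2 - X 1 ^ 2, X 0 * X 1} : Set (MvPolynomial (Fin 2) k))

noncomputable def x' (k : Type*) [Field k] : R' k := Ideal.Quotient.mk _ (X 0)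
noncomputable def y' (k : Type*) [Field k] : R' k := Ideal.Quotient.mk _ (X 1)

/-- The map `R² → R` with `(u, v) ↦ u a + v b`, whose image is the ideal `(a, b)`. -/
noncomputable def aug (k : Type*) [Field k] : (Fin 2 → R k) →ₗ[R k] R k :=
  Fintype.linearCombination (R k) ![a k, b k]

def mat1 {A : Type*} [CommRing A] (x y a b : A) : Matrix (Fin 2) (Fin 3) A :=
  !![x, 0, b;
    -y, x, -a]

def mat2 {A : Type*} [CommRing A] (x y a b : A) : Matrix (Fin 3) (Fin 6) A :=
  !![y, 0, b, 0, -b, -a;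
    x, y, a, b, 0, 0;
    0, 0, 0, 0, x, y]

def mat3 {A : Type*} [CommRing A] (x y a b : A) : Matrix (Fin 6) (Fin 11) A :=
  !![x, 0, 0, -b, 0, 0, b, b, a, 0, 0;
    -y, x, -b, -a, 0, -b, 0, 0, -b, 0, 0;
    0, 0, x, y, 0, 0, 0, 0, 0, 0, b;
    0, 0, 0, 0, x, y, 0, 0, 0, 0, -a;
    0, 0, 0, 0, 0, 0, y, 0, -x, a, b;
    0, 0, 0, 0, 0, 0, 0, x, y, -b, 0]

def mat4 {A : Type*} [CommRing A] (x y a b : A) : Matrix (Fin 11) (Fin 20) A :=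
  !![y, 0, b, 0, -b, -b, -a, 0, 0, -b, 0, 0, 0, 0, 0, 0, 0, 0, 0, 0;
    x, y, a, b, 0, 0, 0, 0, 0, 0, 0, 0, 0, 0, 0, 0, 0, 0, 0, 0;
    0, 0, 0, 0, y, 0, -x, 0, 0, 0, 0, 0, 0, -b, -a, -b, a, 0, 0, 0;
    0, 0, 0, 0, 0, x, y, 0, 0, 0, 0, 0, 0, 0, b, 0, -b, 0, 0, -b;
    0, 0, 0, 0, 0, 0, 0, y, 0, -x, 0, 0, b, -a, 0, 0, 0, 0, a, 0;
    0, 0, 0, 0, 0, 0, 0, 0, x, y, 0, 0, 0, b, 0, 0, 0, 0, 0, a;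
    0, 0, 0, 0, 0, 0, 0, 0, 0, 0, x, y, 0, 0, 0, 0, -b, -a, 0, -b;
    0, 0, 0, 0, 0, 0, 2 * y, 0, 0, 0, 0, -2 * y, 0, 0, b, -a, 0, a, 0, 0;
    0, 0, 0, 0, 0, 0, 0, 0, 0, 0, 0, x, 0, 0, 0, b, 0, 0, 0, 0;
    0, 0, 0, 0, 0, 0, 0, 0, 0, 0, 0, 0, 0, 0, 0, 0, x, y, 0, 0;
    0, 0, 0, 0, 0, 0, 0, 0, 0, 0, 0, 0, 0, 0, 0, 0, 0, 0, x, y]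

/-- `∂₁ : R(-2)³ → R(-1)²`. -/
noncomputable def d1 (k : Type*) [Field k] : Matrix (Fin 2) (Fin 3) (R k) :=
  mat1 (x k) (y k) (a k) (b k)

/-- `∂₂ : R(-3)⁶ → R(-2)³`. -/
noncomputable def d2 (k : Type*) [Field k] : Matrix (Fin 3) (Fin 6) (R k) :=
  mat2 (x k) (y k) (a k) (b k)

/-- `∂₃ : R(-4)¹¹ → R(-3)⁶`. -/
noncomputable def d3 (k : Type*) [Field k] : Matrix (Fin 6) (Fin 11) (R k) :=
  mat3 (x k) (y k) (a k) (b k)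

/-- `∂₄ : R(-5)²⁰ → R(-4)¹¹`. -/
noncomputable def d4 (k : Type*) [Field k] : Matrix (Fin 11) (Fin 20) (R k) :=
  mat4 (x k) (y k) (a k) (b k)

end BadAlgebra

namespace BadAlgebra

/-! ### Consequences of the four defining relations. -/

section Relations

variable {k : Type*} [Field k]

/-! The elements `aⁱbʲ`, `aⁱx`, `aⁱy`, `x²` span `R`. They are independent because the four
variables act, compatibly with the relations, on the space of expected coordinates; `coord` and
`ofCoord` are mutually inverse. An equation in `R` thus becomes a list of identities between
polynomials in `a` and `b`.

Exactness is a Gröbner-style argument, `range_eq_of_reduced`. Combinations of columns provide,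
position by position, ideals of leading entries; subtracting elements of the image brings any vector
to a normal form, and a kernel vector in normal form is seen to be zero by comparing coordinates.
Minimality holds because the constant terms of a syzygy can be read off from the linear coefficients
of the rows.

The characteristic enters through a factor `2`. Counting from zero, `x²e₇` is always a syzygy of
`∂₃`. If `2 = 0`, the coefficient of `x²` in coordinate 7 vanishes on `R₊ · ker ∂₃`, so this syzygy
is minimal. If `2` is invertible, `x²e₇` is half of `x` times column 10 minus `y` times column 11 of
`∂₄`, and it is `x²e₁₁` that is a minimal syzygy of `∂₄`. Both cases use `functional_eq_zero`.

For the failure of the Koszul property, let `P` be the linear complex with ranks `1, 2, 3, …` that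
resolves `k` over `R'`. Since `R'` is a retract, `P` is also a complex over `R`. Its tensor product
with the known linear part `N` of the resolution of `R'` over `R` is a total complex that contains
`N` as the part `p = 0`. Given a linear resolution `D` of `k` over `R`, there are maps `N → D → Tot`
with constant entries, and uniqueness of such maps makes the composite the inclusion. A quadratic
syzygy `s` of `N` goes to a quadratic cycle of `D`, which is the image of a linear vector `t`.
Carrying this equation to `Tot` exhibits `s` in `R₊ · ker N`, so `s` is not minimal
(`IsLinearStrand.sum_smul_mem`, `IsLinearStrand.not_isKoszulAlgebra`). -/

theorem b_mul_x : b k * x k = 0 :=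
  Ideal.Quotient.eq_zero_iff_mem.2 (Ideal.subset_span (by simp [relations]))

theorem x_mul_y : x k * y k = 0 :=
  Ideal.Quotient.eq_zero_iff_mem.2 (Ideal.subset_span (by simp [relations]))

theorem a_mul_x : a k * x k = b k * y k :=
  Ideal.Quotient.eq.2 (Ideal.subset_span (by simp [relations]))

theorem x_mul_x : x k * x k = y k * y k := by
  have h : x k ^ 2 = y k ^ 2 :=
    Ideal.Quotient.eq.2 (Ideal.subset_span (by simp [relations]))
  simpa [pow_two] using h

theorem y_mul_x : y k * x k = 0 := by rw [mul_comm, x_mul_y]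

theorem a_mul_x_mul_x : a k * (x k * x k) = 0 := by
  linear_combination x k * a_mul_x (k := k) + b k * x_mul_y (k := k)

theorem x_mul_x_mul_x : x k * (x k * x k) = 0 := by
  linear_combination x k * x_mul_x (k := k) + y k * x_mul_y (k := k)

theorem b_mul_b_mul_y : b k * (b k * y k) = 0 := by
  linear_combination (-b k) * a_mul_x (k := k) + a k * b_mul_x (k := k)

end Relations

/-! ### A monomial basis of `R`, from an explicit module. -/

section Model

open Polynomial

variable (k : Type*) [Field k]

/-- Coordinates on `R` in the basis `aⁱbʲ, aⁱx, aⁱy, x²`. -/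
abbrev Coord : Type _ := k[X][X] × k[X] × k[X] × k

/-- Multiplication by `x` in coordinates. -/
noncomputable def opX : Module.End k (Coord k) where
  toFun w := (0, w.1.coeff 0, 0, w.2.1.coeff 0)
  map_add' v w := by simp
  map_smul' c w := by simp

/-- Multiplication by `y` in coordinates. -/
noncomputable def opY : Module.End k (Coord k) where
  toFun w := (0, X * w.1.coeff 1, w.1.coeff 0, w.2.2.1.coeff 0)
  map_add' v w := by simp [mul_add]
  map_smul' c w := by simp

/-- Multiplication by `a` in coordinates. -/
noncomputable def opA : Module.End k (Coord k) where
  toFun w := (C X * w.1, X * w.2.1, X * w.2.2.1, 0)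
  map_add' v w := by simp [mul_add]
  map_smul' c w := by simp

/-- Multiplication by `b` in coordinates. -/
noncomputable def opB : Module.End k (Coord k) where
  toFun w := (X * w.1, X * w.2.2.1, 0, 0)
  map_add' v w := by simp [mul_add]
  map_smul' c w := by simp

/-- The four multiplication operators. -/
noncomputable def ops : Fin 4 → Module.End k (Coord k) := ![opX k, opY k, opA k, opB k]

theorem ops_comm (i j : Fin 4) : ops k i * ops k j = ops k j * ops k i := by
  refine LinearMap.ext fun w => ?_
  fin_cases i <;> fin_cases j <;>
    simp [ops, opX, opY, opA, opB, mul_left_comm]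

open scoped IsMulCommutative in
/-- The polynomial ring acts on the coordinates. -/
noncomputable def polyAction : MvPolynomial (Fin 4) k →ₐ[k] Module.End k (Coord k) :=
  -- `aeval` needs a commutative target, so the variables are evaluated in the subalgebra generated
  -- by the commuting operators.
  haveI : IsMulCommutative (Algebra.adjoin k (Set.range (ops k))) :=
    Algebra.isMulCommutative_adjoin k (by
      rintro _ ⟨i, rfl⟩ _ ⟨j, rfl⟩
      exact ops_comm k i j)
  (Algebra.adjoin k (Set.range (ops k))).val.comp
    (MvPolynomial.aeval (R := k) fun i =>
      (⟨ops k i, Algebra.subset_adjoin ⟨i, rfl⟩⟩ : Algebra.adjoin k (Set.range (ops k))))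

theorem polyAction_X (i : Fin 4) : polyAction k (MvPolynomial.X i) = ops k i := by
  simp [polyAction]

theorem polyAction_relations (p : MvPolynomial (Fin 4) k)
    (hp : p ∈ Ideal.span (relations k)) : polyAction k p = 0 := by
  have hle : Ideal.span (relations k) ≤ RingHom.ker (polyAction k) := by
    refine Ideal.span_le.2 ?_
    rintro q (rfl | rfl | rfl | rfl) <;>
    · change polyAction k _ = 0
      refine LinearMap.ext fun w => ?_
      simp [polyAction_X, pow_two, ops, opX, opY, opA, opB]
  exact hle hp

/-- `R` acts on its coordinates. -/
noncomputable def action : R k →ₐ[k] Module.End k (Coord k) :=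
  Ideal.Quotient.liftₐ (Ideal.span (relations k)) (polyAction k) (polyAction_relations k)

/-- The coordinates of an element of `R`. -/
noncomputable def coord : R k →ₗ[k] Coord k :=
  (LinearMap.applyₗ (R := k) ((1, 0, 0, 0) : Coord k)).comp (action k).toLinearMap

variable {k}

theorem action_x : action k (x k) = opX k := polyAction_X k 0
theorem action_y : action k (y k) = opY k := polyAction_X k 1
theorem action_a : action k (a k) = opA k := polyAction_X k 2
theorem action_b : action k (b k) = opB k := polyAction_X k 3

theorem coord_x_mul (r : R k) : coord k (x k * r) = opX k (coord k r) := by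
  simp [coord, action_x]

theorem coord_y_mul (r : R k) : coord k (y k * r) = opY k (coord k r) := by
  simp [coord, action_y]

theorem coord_a_mul (r : R k) : coord k (a k * r) = opA k (coord k r) := by
  simp [coord, action_a]

theorem coord_b_mul (r : R k) : coord k (b k * r) = opB k (coord k r) := by
  simp [coord, action_b]

theorem coord_one : coord k 1 = (1, 0, 0, 0) := by
  simp [coord]

theorem coord_algebraMap (c : k) : coord k (algebraMap k (R k) c) = (C (C c), 0, 0, 0) := by
  rw [Algebra.algebraMap_eq_smul_one, map_smul, coord_one]
  simpa using (Algebra.algebraMap_eq_smul_one (A := k[X][X]) c).symm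

/-- The element of `R` with given coordinates. -/
noncomputable def ofCoord (w : Coord k) : R k :=
  w.1.eval₂ (aeval (a k)).toRingHom (b k) + aeval (a k) w.2.1 * x k + aeval (a k) w.2.2.1 * y k +
    algebraMap k (R k) w.2.2.2 * (x k * x k)

theorem aeval_a_eq (g : k[X]) :
    aeval (a k) g = aeval (a k) g.divX * a k + algebraMap k (R k) (g.coeff 0) := by
  conv_lhs => rw [← g.divX_mul_X_add]
  simp

theorem eval₂_b_eq (f : k[X][X]) : f.eval₂ (aeval (a k)).toRingHom (b k) =
    f.divX.eval₂ (aeval (a k)).toRingHom (b k) * b k + aeval (a k) (f.coeff 0) := by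
  conv_lhs => rw [← f.divX_mul_X_add]
  simp [eval₂_add, eval₂_mul]

theorem ofCoord_add (v w : Coord k) : ofCoord (v + w) = ofCoord v + ofCoord w := by
  simp only [ofCoord, Prod.fst_add, Prod.snd_add, eval₂_add, map_add]
  ring

/-- Splitting off constant coefficients with `divX` isolates the products that vanish, here `bx`,
`ax²`, `xy` and `x³`. With its three analogues this makes `ofCoord` compatible with the operators.
-/
theorem ofCoord_opX (w : Coord k) : ofCoord (opX k w) = x k * ofCoord w := by
  simp only [ofCoord, opX, LinearMap.coe_mk, AddHom.coe_mk, eval₂_zero, map_zero]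
  rw [eval₂_b_eq w.1, aeval_a_eq w.2.1]
  linear_combination (-eval₂ (aeval (a k)).toRingHom (b k) w.1.divX) * b_mul_x (k := k)
    - aeval (a k) w.2.1.divX * a_mul_x_mul_x (k := k) - aeval (a k) w.2.2.1 * x_mul_y (k := k)
    - algebraMap k (R k) w.2.2.2 * x_mul_x_mul_x (k := k)

theorem ofCoord_opY (w : Coord k) : ofCoord (opY k w) = y k * ofCoord w := by
  simp only [ofCoord, opY, LinearMap.coe_mk, AddHom.coe_mk, eval₂_zero, map_mul, aeval_X]
  rw [eval₂_b_eq w.1, eval₂_b_eq w.1.divX, aeval_a_eq w.2.2.1, coeff_divX]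
  linear_combination
    (-eval₂ (aeval (a k)).toRingHom (b k) w.1.divX.divX) * b_mul_b_mul_y (k := k)
    + aeval (a k) (w.1.coeff (0 + 1)) * a_mul_x (k := k)
    - (aeval (a k) w.2.1 + algebraMap k (R k) w.2.2.2 * x k) * x_mul_y (k := k)
    - aeval (a k) w.2.2.1.divX * a_mul_x_mul_x (k := k)
    + (aeval (a k) w.2.2.1.divX * a k + algebraMap k (R k) (w.2.2.1.coeff 0)) * x_mul_x (k := k)

theorem ofCoord_opA (w : Coord k) : ofCoord (opA k w) = a k * ofCoord w := by
  simp only [ofCoord, opA, LinearMap.coe_mk, AddHom.coe_mk, eval₂_mul, eval₂_C, map_zero, map_mul,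
    aeval_X, AlgHom.toRingHom_eq_coe, RingHom.coe_coe]
  linear_combination (-algebraMap k (R k) w.2.2.2) * a_mul_x_mul_x (k := k)

theorem ofCoord_opB (w : Coord k) : ofCoord (opB k w) = b k * ofCoord w := by
  simp only [ofCoord, opB, LinearMap.coe_mk, AddHom.coe_mk, eval₂_mul, eval₂_X, map_zero, map_mul,
    aeval_X]
  linear_combination aeval (a k) w.2.2.1 * a_mul_x (k := k)
    - (aeval (a k) w.2.1 + algebraMap k (R k) w.2.2.2 * x k) * b_mul_x (k := k)

/-- The spanning half: both maps are compatible with the variables, and these generate `R` from the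
constants. -/
theorem ofCoord_coord (r : R k) : ofCoord (coord k r) = r := by
  obtain ⟨p, rfl⟩ := Ideal.Quotient.mk_surjective r
  induction p using MvPolynomial.induction_on with
  | C c =>
    have h : Ideal.Quotient.mk (Ideal.span (relations k)) (MvPolynomial.C c)
        = algebraMap k (R k) c := rfl
    rw [h, coord_algebraMap]
    simp [ofCoord]
  | add p q hp hq => rw [map_add, map_add, ofCoord_add, hp, hq]
  | mul_X p i hp =>
    rw [map_mul, mul_comm]
    fin_cases i
    · exact (congrArg ofCoord (coord_x_mul _)).trans ((ofCoord_opX _).trans (congrArg _ hp))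
    · exact (congrArg ofCoord (coord_y_mul _)).trans ((ofCoord_opY _).trans (congrArg _ hp))
    · exact (congrArg ofCoord (coord_a_mul _)).trans ((ofCoord_opA _).trans (congrArg _ hp))
    · exact (congrArg ofCoord (coord_b_mul _)).trans ((ofCoord_opB _).trans (congrArg _ hp))

theorem coord_injective : Function.Injective (coord k) :=
  Function.LeftInverse.injective ofCoord_coord

/-- The independence half: every coordinate vector is a sum of vectors reached from constants by the
operators, with powers of `a` first, then powers of `b`, or a single `x`, a single `y`, or `x`
twice. -/
theorem coord_ofCoord (w : Coord k) : coord k (ofCoord w) = w := by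
  have hadd : ∀ v w : Coord k, coord k (ofCoord v) = v → coord k (ofCoord w) = w →
      coord k (ofCoord (v + w)) = v + w := fun v w hv hw => by
    rw [ofCoord_add, map_add, hv, hw]
  have hX : ∀ w : Coord k, coord k (ofCoord w) = w → coord k (ofCoord (opX k w)) = opX k w :=
    fun w hw => by rw [ofCoord_opX, coord_x_mul, hw]
  have hY : ∀ w : Coord k, coord k (ofCoord w) = w → coord k (ofCoord (opY k w)) = opY k w :=
    fun w hw => by rw [ofCoord_opY, coord_y_mul, hw]
  have hA : ∀ w : Coord k, coord k (ofCoord w) = w → coord k (ofCoord (opA k w)) = opA k w :=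
    fun w hw => by rw [ofCoord_opA, coord_a_mul, hw]
  have hB : ∀ w : Coord k, coord k (ofCoord w) = w → coord k (ofCoord (opB k w)) = opB k w :=
    fun w hw => by rw [ofCoord_opB, coord_b_mul, hw]
  have hc : ∀ c : k, coord k (ofCoord (C (C c), 0, 0, 0)) = (C (C c), 0, 0, 0) := fun c => by
    have h : (ofCoord (C (C c), 0, 0, 0) : R k) = algebraMap k (R k) c := by simp [ofCoord]
    rw [h, coord_algebraMap]
  have hg : ∀ g : k[X], coord k (ofCoord (C g, 0, 0, 0)) = (C g, 0, 0, 0) := fun g => by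
    induction g using Polynomial.induction_on' with
    | add p q hp hq => simpa using hadd _ _ hp hq
    | monomial n c =>
      induction n with
      | zero => exact hc c
      | succ n ih =>
        have h := hA _ ih
        simpa [opA, ← C_mul, X_mul_monomial] using h
  have hf : ∀ f : k[X][X], coord k (ofCoord (f, 0, 0, 0)) = (f, 0, 0, 0) := fun f => by
    induction f using Polynomial.induction_on' with
    | add p q hp hq => simpa using hadd _ _ hp hq
    | monomial n g =>
      induction n with
      | zero => exact hg g
      | succ n ih =>
        have h := hB _ ih
        simpa [opB, X_mul_monomial] using h
  obtain ⟨f, g, h, c⟩ := w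
  have h2 : coord k (ofCoord (0, g, 0, 0)) = (0, g, 0, 0) := by simpa [opX] using hX _ (hg g)
  have h3 : coord k (ofCoord (0, 0, h, 0)) = (0, 0, h, 0) := by
    simpa [opY, coeff_C] using hY _ (hg h)
  have h4 : coord k (ofCoord (0, 0, 0, c)) = (0, 0, 0, c) := by
    simpa [opX] using hX _ (hX _ (hc c))
  simpa using hadd _ _ (hadd _ _ (hadd _ _ (hf f) h2) h3) h4

end Model
end BadAlgebra

namespace BadAlgebra

open Polynomial

variable {k : Type*} [Field k]

/-! ### Coordinate functionals. -/

section Coordinates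

/-- The component of an element of `R` in `k[a, b]`. -/
noncomputable def cF : R k →ₗ[k] k[X][X] := (LinearMap.fst k _ _).comp (coord k)

/-- The coefficient of `x` in `k[a]`. -/
noncomputable def cG : R k →ₗ[k] k[X] :=
  (LinearMap.fst k _ _).comp ((LinearMap.snd k _ _).comp (coord k))

/-- The coefficient of `y` in `k[a]`. -/
noncomputable def cH : R k →ₗ[k] k[X] :=
  (LinearMap.fst k _ _).comp ((LinearMap.snd k _ _).comp ((LinearMap.snd k _ _).comp (coord k)))

/-- The coefficient of `x²`. -/
noncomputable def cS : R k →ₗ[k] k :=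
  (LinearMap.snd k _ _).comp ((LinearMap.snd k _ _).comp ((LinearMap.snd k _ _).comp (coord k)))

theorem ext_coord {r s : R k} (hF : cF r = cF s) (hG : cG r = cG s) (hH : cH r = cH s)
    (hS : cS r = cS s) : r = s :=
  coord_injective (Prod.ext hF (Prod.ext hG (Prod.ext hH hS)))

@[simp] theorem cF_x_mul (r : R k) : cF (x k * r) = 0 := congrArg (·.1) (coord_x_mul r)
@[simp] theorem cG_x_mul (r : R k) : cG (x k * r) = (cF r).coeff 0 := congrArg (·.2.1) (coord_x_mul r)
@[simp] theorem cH_x_mul (r : R k) : cH (x k * r) = 0 := congrArg (·.2.2.1) (coord_x_mul r)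
@[simp] theorem cS_x_mul (r : R k) : cS (x k * r) = (cG r).coeff 0 := congrArg (·.2.2.2) (coord_x_mul r)

@[simp] theorem cF_y_mul (r : R k) : cF (y k * r) = 0 := congrArg (·.1) (coord_y_mul r)
@[simp] theorem cG_y_mul (r : R k) : cG (y k * r) = X * (cF r).coeff 1 :=
  congrArg (·.2.1) (coord_y_mul r)
@[simp] theorem cH_y_mul (r : R k) : cH (y k * r) = (cF r).coeff 0 := congrArg (·.2.2.1) (coord_y_mul r)
@[simp] theorem cS_y_mul (r : R k) : cS (y k * r) = (cH r).coeff 0 := congrArg (·.2.2.2) (coord_y_mul r)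

@[simp] theorem cF_a_mul (r : R k) : cF (a k * r) = C X * cF r := congrArg (·.1) (coord_a_mul r)
@[simp] theorem cG_a_mul (r : R k) : cG (a k * r) = X * cG r := congrArg (·.2.1) (coord_a_mul r)
@[simp] theorem cH_a_mul (r : R k) : cH (a k * r) = X * cH r := congrArg (·.2.2.1) (coord_a_mul r)
@[simp] theorem cS_a_mul (r : R k) : cS (a k * r) = 0 := congrArg (·.2.2.2) (coord_a_mul r)

@[simp] theorem cF_b_mul (r : R k) : cF (b k * r) = X * cF r := congrArg (·.1) (coord_b_mul r)
@[simp] theorem cG_b_mul (r : R k) : cG (b k * r) = X * cH r := congrArg (·.2.1) (coord_b_mul r)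
@[simp] theorem cH_b_mul (r : R k) : cH (b k * r) = 0 := congrArg (·.2.2.1) (coord_b_mul r)
@[simp] theorem cS_b_mul (r : R k) : cS (b k * r) = 0 := congrArg (·.2.2.2) (coord_b_mul r)

@[simp] theorem cF_algebraMap (c : k) : cF (algebraMap k (R k) c) = C (C c) :=
  congrArg Prod.fst (coord_algebraMap c)
@[simp] theorem cG_algebraMap (c : k) : cG (algebraMap k (R k) c) = 0 :=
  congrArg (fun w => w.2.1) (coord_algebraMap c)
@[simp] theorem cH_algebraMap (c : k) : cH (algebraMap k (R k) c) = 0 :=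
  congrArg (fun w => w.2.2.1) (coord_algebraMap c)
@[simp] theorem cS_algebraMap (c : k) : cS (algebraMap k (R k) c) = 0 :=
  congrArg (fun w => w.2.2.2) (coord_algebraMap c)

theorem cF_ofCoord (w : Coord k) : cF (ofCoord w) = w.1 :=
  congrArg Prod.fst (coord_ofCoord w)
theorem cG_ofCoord (w : Coord k) : cG (ofCoord w) = w.2.1 :=
  congrArg (fun w => w.2.1) (coord_ofCoord w)
theorem cH_ofCoord (w : Coord k) : cH (ofCoord w) = w.2.2.1 :=
  congrArg (fun w => w.2.2.1) (coord_ofCoord w)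
theorem cS_ofCoord (w : Coord k) : cS (ofCoord w) = w.2.2.2 :=
  congrArg (fun w => w.2.2.2) (coord_ofCoord w)

theorem eq_expand (r : R k) : r = (cF r).eval₂ (aeval (a k)).toRingHom (b k)
    + aeval (a k) (cG r) * x k + aeval (a k) (cH r) * y k
    + algebraMap k (R k) (cS r) * (x k * x k) :=
  (ofCoord_coord r).symm

/-- The constant term. -/
noncomputable def ct (r : R k) : k := ((cF r).coeff 0).coeff 0

theorem ct_algebraMap (c : k) : ct (algebraMap k (R k) c) = c := by
  simp [ct, cF_algebraMap]

theorem ct_add (r s : R k) : ct (r + s) = ct r + ct s := by simp [ct]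
@[simp] theorem ct_x_mul (r : R k) : ct (x k * r) = 0 := by simp [ct, cF_x_mul]
@[simp] theorem ct_y_mul (r : R k) : ct (y k * r) = 0 := by simp [ct, cF_y_mul]
@[simp] theorem ct_a_mul (r : R k) : ct (a k * r) = 0 := by simp [ct, cF_a_mul]
@[simp] theorem ct_b_mul (r : R k) : ct (b k * r) = 0 := by simp [ct, cF_b_mul]

end Coordinates

/-! ### Representatives modulo the ideals of leading entries. -/

section Reduction

variable {I : Ideal (R k)}

/-- Sort the terms of the expansion of `r` by a generator of `I` that divides them; the term in `x²`
counts as a multiple of `y` because `x² = y²`. The other reductions follow the same pattern. -/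
theorem exists_reduced_yab (hy : y k ∈ I) (ha : a k ∈ I) (hb : b k ∈ I) (r : R k) :
    ∃ s : R k, r - s ∈ I ∧ (∃ p : k, cF s = C (C p)) ∧ (∃ q : k, cG s = C q) ∧
      cH s = 0 ∧ cS s = 0 := by
  refine ⟨ofCoord (C (C (ct r)), C ((cG r).coeff 0), 0, 0), ?_, ⟨_, cF_ofCoord _⟩,
    ⟨_, cG_ofCoord _⟩, cH_ofCoord _, cS_ofCoord _⟩
  have hr : r - ofCoord (C (C (ct r)), C ((cG r).coeff 0), 0, 0) =
      (cF r).divX.eval₂ (aeval (a k)).toRingHom (b k) * b k +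
      (aeval (a k) ((cF r).coeff 0).divX + aeval (a k) (cG r).divX * x k) * a k +
      (aeval (a k) (cH r) + algebraMap k (R k) (cS r) * y k) * y k := by
    conv_lhs => lhs; rw [eq_expand r]
    rw [eval₂_b_eq, aeval_a_eq (cG r), aeval_a_eq ((cF r).coeff 0)]
    simp [ofCoord, ct]
    linear_combination algebraMap k (R k) (cS r) * x_mul_x (k := k)
  rw [hr]
  exact I.add_mem (I.add_mem (I.mul_mem_left _ hb) (I.mul_mem_left _ ha)) (I.mul_mem_left _ hy)

theorem exists_reduced_xab (hx : x k ∈ I) (ha : a k ∈ I) (hb : b k ∈ I) (r : R k) :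
    ∃ s : R k, r - s ∈ I ∧ (∃ p : k, cF s = C (C p)) ∧ cG s = 0 ∧ (∃ q : k, cH s = C q) ∧
      cS s = 0 := by
  refine ⟨ofCoord (C (C (ct r)), 0, C ((cH r).coeff 0), 0), ?_, ⟨_, cF_ofCoord _⟩,
    cG_ofCoord _, ⟨_, cH_ofCoord _⟩, cS_ofCoord _⟩
  have hr : r - ofCoord (C (C (ct r)), 0, C ((cH r).coeff 0), 0) =
      (cF r).divX.eval₂ (aeval (a k)).toRingHom (b k) * b k +
      (aeval (a k) ((cF r).coeff 0).divX + aeval (a k) (cH r).divX * y k) * a k +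
      (aeval (a k) (cG r) + algebraMap k (R k) (cS r) * x k) * x k := by
    conv_lhs => lhs; rw [eq_expand r]
    rw [eval₂_b_eq, aeval_a_eq (cH r), aeval_a_eq ((cF r).coeff 0)]
    simp [ofCoord, ct]
    ring
  rw [hr]
  exact I.add_mem (I.add_mem (I.mul_mem_left _ hb) (I.mul_mem_left _ ha)) (I.mul_mem_left _ hx)

theorem exists_reduced_xyab (hx : x k ∈ I) (hy : y k ∈ I) (ha : a k ∈ I) (hb : b k ∈ I)
    (r : R k) : ∃ s : R k, r - s ∈ I ∧ (∃ p : k, cF s = C (C p)) ∧ cG s = 0 ∧ cH s = 0 ∧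
      cS s = 0 := by
  refine ⟨ofCoord (C (C (ct r)), 0, 0, 0), ?_, ⟨_, cF_ofCoord _⟩,
    cG_ofCoord _, cH_ofCoord _, cS_ofCoord _⟩
  have hr : r - ofCoord (C (C (ct r)), 0, 0, 0) =
      (cF r).divX.eval₂ (aeval (a k)).toRingHom (b k) * b k +
      aeval (a k) ((cF r).coeff 0).divX * a k + aeval (a k) (cH r) * y k +
      (aeval (a k) (cG r) + algebraMap k (R k) (cS r) * x k) * x k := by
    conv_lhs => lhs; rw [eq_expand r]
    rw [eval₂_b_eq, aeval_a_eq ((cF r).coeff 0)]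
    simp [ofCoord, ct]
    ring
  rw [hr]
  exact I.add_mem (I.add_mem (I.add_mem (I.mul_mem_left _ hb) (I.mul_mem_left _ ha))
    (I.mul_mem_left _ hy)) (I.mul_mem_left _ hx)

theorem exists_reduced_xb (hx : x k ∈ I) (hb : b k ∈ I) (r : R k) :
    ∃ s : R k, r - s ∈ I ∧ (∃ f : k[X], cF s = C f) ∧ cG s = 0 ∧ cS s = 0 := by
  refine ⟨ofCoord (C ((cF r).coeff 0), 0, cH r, 0), ?_, ⟨_, cF_ofCoord _⟩,
    cG_ofCoord _, cS_ofCoord _⟩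
  have hr : r - ofCoord (C ((cF r).coeff 0), 0, cH r, 0) =
      (cF r).divX.eval₂ (aeval (a k)).toRingHom (b k) * b k +
      (aeval (a k) (cG r) + algebraMap k (R k) (cS r) * x k) * x k := by
    conv_lhs => lhs; rw [eq_expand r]
    rw [eval₂_b_eq]
    simp [ofCoord]
    ring
  rw [hr]
  exact I.add_mem (I.mul_mem_left _ hb) (I.mul_mem_left _ hx)

theorem exists_reduced_x (hx : x k ∈ I) (r : R k) :
    ∃ s : R k, r - s ∈ I ∧ cG s = 0 ∧ cS s = 0 := by
  refine ⟨ofCoord (cF r, 0, cH r, 0), ?_, cG_ofCoord _, cS_ofCoord _⟩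
  have hr : r - ofCoord (cF r, 0, cH r, 0) =
      (aeval (a k) (cG r) + algebraMap k (R k) (cS r) * x k) * x k := by
    conv_lhs => lhs; rw [eq_expand r]
    simp [ofCoord]
    ring
  rw [hr]
  exact I.mul_mem_left _ hx

/-- In each coefficient `g(a)` of a power of `b`, the difference `g(a) - g(0)` is a multiple of `a`.
-/
theorem eval₂_sub_eval₂_mem (ha : a k ∈ I) (f : k[X][X]) :
    f.eval₂ (aeval (a k)).toRingHom (b k) -
      ((f.map (evalRingHom 0)).map C).eval₂ (aeval (a k)).toRingHom (b k) ∈ I := by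
  induction f using Polynomial.induction_on' with
  | add p q hp hq =>
    simp only [eval₂_add, Polynomial.map_add]
    convert I.add_mem hp hq using 1
    ring
  | monomial n g =>
    have h := aeval_a_eq g
    simp only [eval₂_monomial, Polynomial.map_monomial]
    have e : (aeval (a k)).toRingHom g * b k ^ n -
        (aeval (a k)).toRingHom (C (evalRingHom 0 g)) * b k ^ n =
        aeval (a k) g.divX * b k ^ n * a k := by
      simp [h, coeff_zero_eq_eval_zero]
      ring
    rw [e]
    exact I.mul_mem_left _ ha

theorem exists_reduced_ya (hy : y k ∈ I) (ha : a k ∈ I) (r : R k) :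
    ∃ s : R k, r - s ∈ I ∧ (∃ f : k[X], cF s = f.map C) ∧ (∃ q : k, cG s = C q) ∧ cH s = 0 ∧
      cS s = 0 := by
  refine ⟨ofCoord (((cF r).map (evalRingHom 0)).map C, C ((cG r).coeff 0), 0, 0), ?_,
    ⟨_, cF_ofCoord _⟩, ⟨_, cG_ofCoord _⟩, cH_ofCoord _, cS_ofCoord _⟩
  have hr : r - ofCoord (((cF r).map (evalRingHom 0)).map C, C ((cG r).coeff 0), 0, 0) =
      ((cF r).eval₂ (aeval (a k)).toRingHom (b k) -
      (((cF r).map (evalRingHom 0)).map C).eval₂ (aeval (a k)).toRingHom (b k)) +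
      aeval (a k) (cG r).divX * x k * a k +
      (aeval (a k) (cH r) + algebraMap k (R k) (cS r) * y k) * y k := by
    conv_lhs => lhs; rw [eq_expand r]
    rw [aeval_a_eq (cG r)]
    simp only [ofCoord, aeval_C, map_zero]
    linear_combination algebraMap k (R k) (cS r) * x_mul_x (k := k)
  rw [hr]
  exact I.add_mem (I.add_mem (eval₂_sub_eval₂_mem ha _) (I.mul_mem_left _ ha))
    (I.mul_mem_left _ hy)

theorem exists_reduced_xx (hx : x k * x k ∈ I) (r : R k) :
    ∃ s : R k, r - s ∈ I ∧ cS s = 0 := by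
  refine ⟨ofCoord (cF r, cG r, cH r, 0), ?_, cS_ofCoord _⟩
  have hr : r - ofCoord (cF r, cG r, cH r, 0) = algebraMap k (R k) (cS r) * (x k * x k) := by
    conv_lhs => lhs; rw [eq_expand r]
    simp [ofCoord]
  rw [hr]
  exact I.mul_mem_left _ hx

theorem exists_reduced_ax_ay_xx (hax : a k * x k ∈ I) (hay : a k * y k ∈ I)
    (hx : x k * x k ∈ I) (r : R k) : ∃ s : R k, r - s ∈ I ∧ (∃ q : k, cG s = C q) ∧
      (∃ q : k, cH s = C q) ∧ cS s = 0 := by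
  refine ⟨ofCoord (cF r, C ((cG r).coeff 0), C ((cH r).coeff 0), 0), ?_, ⟨_, cG_ofCoord _⟩,
    ⟨_, cH_ofCoord _⟩, cS_ofCoord _⟩
  have hr : r - ofCoord (cF r, C ((cG r).coeff 0), C ((cH r).coeff 0), 0) =
      aeval (a k) (cG r).divX * (a k * x k) + aeval (a k) (cH r).divX * (a k * y k) +
      algebraMap k (R k) (cS r) * (x k * x k) := by
    conv_lhs => lhs; rw [eq_expand r]
    rw [aeval_a_eq (cG r), aeval_a_eq (cH r)]
    simp [ofCoord]
    ring
  rw [hr]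
  exact I.add_mem (I.add_mem (I.mul_mem_left _ hax) (I.mul_mem_left _ hay)) (I.mul_mem_left _ hx)

end Reduction

/-! ### The irrelevant ideal and linear forms. -/

section Grading

theorem x_mem : x k ∈ gr k 1 := mk_mem_stdGrading _ (MvPolynomial.isHomogeneous_X k 0)
theorem y_mem : y k ∈ gr k 1 := mk_mem_stdGrading _ (MvPolynomial.isHomogeneous_X k 1)
theorem a_mem : a k ∈ gr k 1 := mk_mem_stdGrading _ (MvPolynomial.isHomogeneous_X k 2)
theorem b_mem : b k ∈ gr k 1 := mk_mem_stdGrading _ (MvPolynomial.isHomogeneous_X k 3)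

theorem algebraMap_mem (c : k) : algebraMap k (R k) c ∈ gr k 0 :=
  SetLike.algebraMap_mem_graded (gr k) c

/-- The ideal of elements of positive degree. -/
noncomputable abbrev irr (k : Type*) [Field k] : Ideal (R k) :=
  (HomogeneousIdeal.irrelevant (gr k)).toIdeal

theorem mem_irr_of_mem_one {r : R k} (hr : r ∈ gr k 1) : r ∈ irr k := by
  rw [HomogeneousIdeal.mem_iff, HomogeneousIdeal.mem_irrelevant_iff,
    GradedRing.proj_apply, DirectSum.decompose_of_mem_ne (gr k) hr one_ne_zero]

theorem x_mem_irr : x k ∈ irr k := mem_irr_of_mem_one x_mem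
theorem y_mem_irr : y k ∈ irr k := mem_irr_of_mem_one y_mem
theorem a_mem_irr : a k ∈ irr k := mem_irr_of_mem_one a_mem
theorem b_mem_irr : b k ∈ irr k := mem_irr_of_mem_one b_mem

theorem ct_of_mem_span {r : R k} (hr : r ∈ Ideal.span {x k, y k, a k, b k}) : ct r = 0 := by
  obtain ⟨p, z, hz, rfl⟩ := Ideal.mem_span_insert.1 hr
  obtain ⟨q, z, hz', rfl⟩ := Ideal.mem_span_insert.1 hz
  obtain ⟨u, z, hz'', rfl⟩ := Ideal.mem_span_insert.1 hz'
  obtain ⟨v, rfl⟩ := Ideal.mem_span_singleton'.1 hz''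
  simp only [ct_add, mul_comm p, mul_comm q, mul_comm u, mul_comm v, ct_x_mul, ct_y_mul, ct_a_mul,
    ct_b_mul, add_zero]

theorem sub_ct_mem (r : R k) :
    r - algebraMap k (R k) (ct r) ∈ Ideal.span {x k, y k, a k, b k} := by
  have h : ∀ z ∈ ({x k, y k, a k, b k} : Set (R k)), z ∈ Ideal.span {x k, y k, a k, b k} :=
    fun z hz => Ideal.subset_span hz
  obtain ⟨s, hs, ⟨p, hp⟩, hG, hH, hS⟩ := exists_reduced_xyab (h _ (by simp)) (h _ (by simp))
    (h _ (by simp)) (h _ (by simp)) r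
  obtain rfl : s = algebraMap k (R k) p := ext_coord (by rw [hp, cF_algebraMap])
    (by rw [hG, cG_algebraMap]) (by rw [hH, cH_algebraMap]) (by rw [hS, cS_algebraMap])
  have e : ct r = p := by
    have := ct_add (r - algebraMap k (R k) p) (algebraMap k (R k) p)
    rwa [sub_add_cancel, ct_of_mem_span hs, zero_add, ct_algebraMap] at this
  rwa [e]

theorem span_le_irr : Ideal.span {x k, y k, a k, b k} ≤ irr k := by
  refine Ideal.span_le.2 ?_
  rintro z (rfl | rfl | rfl | rfl)
  exacts [x_mem_irr, y_mem_irr, a_mem_irr, b_mem_irr]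

/-- Modulo the ideal of the four variables `r` is its constant term, and a constant in `R₊` is zero
because it equals its own degree-zero part. -/
theorem mem_irr_iff {r : R k} : r ∈ irr k ↔ ct r = 0 := by
  refine ⟨fun hr => ?_, fun h => span_le_irr ?_⟩
  · have h := (irr k).sub_mem hr (span_le_irr (sub_ct_mem r))
    rw [sub_sub_cancel, HomogeneousIdeal.mem_iff, HomogeneousIdeal.mem_irrelevant_iff,
      GradedRing.proj_apply, DirectSum.decompose_of_mem_same (gr k) (algebraMap_mem _)] at h
    rw [← ct_algebraMap (ct r), h]
    simp [ct]
  · simpa [h] using sub_ct_mem r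

theorem irr_eq_span : irr k = Ideal.span {x k, y k, a k, b k} :=
  le_antisymm (fun r hr => by simpa [mem_irr_iff.1 hr] using sub_ct_mem r) span_le_irr

theorem exists_of_mem_one {r : R k} (hr : r ∈ gr k 1) : ∃ u v w z : k,
    r = algebraMap k (R k) u * x k + algebraMap k (R k) v * y k + algebraMap k (R k) w * a k +
      algebraMap k (R k) z * b k := by
  obtain ⟨p, hp, rfl⟩ := hr
  rw [SetLike.mem_coe, MvPolynomial.homogeneousSubmodule_one_eq_span_X,
    Submodule.mem_span_range_iff_exists_fun] at hp
  obtain ⟨c, rfl⟩ := hp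
  refine ⟨c 0, c 1, c 2, c 3, ?_⟩
  simp only [Fin.sum_univ_four, map_add, map_smul, ← Algebra.smul_def]
  rfl

end Grading
end BadAlgebra

namespace BadAlgebra

open Polynomial

/-! ### The matrices as systems of equations, and their consecutive products. -/

section Matrices

variable {A : Type*} [CommRing A] {x y a b : A}

theorem mat1_mulVec (v : Fin 3 → A) : (mat1 x y a b).mulVec v =
    ![x * v 0 + b * v 2, -(y * v 0) + x * v 1 - a * v 2] := by
  funext i
  fin_cases i
  · simp [mat1, Matrix.mulVec, dotProduct, Fin.sum_univ_succ]
  · simp [mat1, Matrix.mulVec, dotProduct, Fin.sum_univ_succ]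
    ring

theorem mat2_mulVec (v : Fin 6 → A) : (mat2 x y a b).mulVec v =
    ![y * v 0 + b * v 2 - b * v 4 - a * v 5,
      x * v 0 + y * v 1 + a * v 2 + b * v 3,
      x * v 4 + y * v 5] := by
  funext i
  fin_cases i <;> simp [mat2, Matrix.mulVec, dotProduct, Fin.sum_univ_succ] <;> ring

theorem mat3_mulVec (v : Fin 11 → A) : (mat3 x y a b).mulVec v =
    ![x * v 0 - b * v 3 + b * v 6 + b * v 7 + a * v 8,
      -(y * v 0) + x * v 1 - b * v 2 - a * v 3 - b * v 5 - b * v 8,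
      x * v 2 + y * v 3 + b * v 10,
      x * v 4 + y * v 5 - a * v 10,
      y * v 6 - x * v 8 + a * v 9 + b * v 10,
      x * v 7 + y * v 8 - b * v 9] := by
  funext i
  fin_cases i <;> simp [mat3, Matrix.mulVec, dotProduct, Fin.sum_univ_succ] <;> ring

theorem mat4_mulVec (v : Fin 20 → A) : (mat4 x y a b).mulVec v =
    ![y * v 0 + b * v 2 - b * v 4 - b * v 5 - a * v 6 - b * v 9,
      x * v 0 + y * v 1 + a * v 2 + b * v 3,
      y * v 4 - x * v 6 - b * v 13 - a * v 14 - b * v 15 + a * v 16,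
      x * v 5 + y * v 6 + b * v 14 - b * v 16 - b * v 19,
      y * v 7 - x * v 9 + b * v 12 - a * v 13 + a * v 18,
      x * v 8 + y * v 9 + b * v 13 + a * v 19,
      x * v 10 + y * v 11 - b * v 16 - a * v 17 - b * v 19,
      2 * (y * v 6) - 2 * (y * v 11) + b * v 14 - a * v 15 + a * v 17,
      x * v 11 + b * v 15,
      x * v 16 + y * v 17,
      x * v 18 + y * v 19] := by
  funext i
  fin_cases i <;> simp [mat4, Matrix.mulVec, dotProduct, Fin.sum_univ_succ] <;> ring

theorem mat1_mul_mat2 (hbx : b * x = 0) (hxy : x * y = 0) (hax : a * x = b * y)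
    (hxx : x * x = y * y) (v : Fin 6 → A) :
    (mat1 x y a b).mulVec ((mat2 x y a b).mulVec v) = 0 := by
  rw [mat2_mulVec, mat1_mulVec]
  funext i
  fin_cases i <;> simp <;> grind

theorem mat2_mul_mat3 (hbx : b * x = 0) (hxy : x * y = 0) (hax : a * x = b * y)
    (hxx : x * x = y * y) (v : Fin 11 → A) :
    (mat2 x y a b).mulVec ((mat3 x y a b).mulVec v) = 0 := by
  rw [mat3_mulVec, mat2_mulVec]
  funext i
  fin_cases i <;> simp <;> grind

/-- This holds in characteristic two as well, where `∂₄` still gives a complex although exactness is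
not claimed. -/
theorem mat3_mul_mat4 (hbx : b * x = 0) (hxy : x * y = 0) (hax : a * x = b * y)
    (hxx : x * x = y * y) (v : Fin 20 → A) :
    (mat3 x y a b).mulVec ((mat4 x y a b).mulVec v) = 0 := by
  rw [mat4_mulVec, mat3_mulVec]
  funext i
  fin_cases i <;> simp <;> grind
end Matrices

variable {k : Type*} [Field k]

/-! ### Leading ideals and the normal form criterion for exactness. -/

section LeadIdeal

variable {A : Type*} [CommRing A] {n : ℕ}

/-- The leading coefficients at position `j` of the elements of `L` whose earlier coordinates
vanish. -/
def leadIdeal (L : Submodule A (Fin n → A)) (j : Fin n) : Ideal A where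
  carrier := {c | ∃ u ∈ L, (∀ i < j, u i = 0) ∧ u j = c}
  zero_mem' := ⟨0, L.zero_mem, fun _ _ => rfl, rfl⟩
  add_mem' := by
    rintro _ _ ⟨u, hu, hu0, rfl⟩ ⟨v, hv, hv0, rfl⟩
    exact ⟨u + v, L.add_mem hu hv, fun i hi => by simp [hu0 i hi, hv0 i hi], rfl⟩
  smul_mem' := by
    rintro c _ ⟨u, hu, hu0, rfl⟩
    exact ⟨c • u, L.smul_mem c hu, fun i hi => by simp [hu0 i hi], rfl⟩

theorem mem_leadIdeal {m : ℕ} {M : Matrix (Fin n) (Fin m) A} {j : Fin n} {c : A} (w : Fin m → A)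
    (h0 : ∀ i < j, M.mulVec w i = 0) (hj : M.mulVec w j = c) :
    c ∈ leadIdeal (LinearMap.range M.mulVecLin) j :=
  ⟨M.mulVec w, ⟨w, rfl⟩, h0, hj⟩

/-- Normalise the coordinates from left to right: the element of `L` used at position `m` vanishes
at all earlier positions, so it does not spoil what has been achieved. -/
theorem exists_reduced (L : Submodule A (Fin n → A)) (P : Fin n → A → Prop)
    (h : ∀ j r, ∃ s, r - s ∈ leadIdeal L j ∧ P j s) (v : Fin n → A) :
    ∃ s, v - s ∈ L ∧ ∀ j, P j (s j) := by
  have key : ∀ m ≤ n, ∃ s, v - s ∈ L ∧ ∀ j : Fin n, j.1 < m → P j (s j) := by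
    intro m
    induction m with
    | zero => exact fun _ => ⟨v, by simp, fun j hj => absurd hj (by omega)⟩
    | succ m ih =>
      intro hm
      obtain ⟨s, hs, hP⟩ := ih (by omega)
      obtain ⟨r, ⟨u, hu, hu0, huj⟩, hr⟩ := h ⟨m, hm⟩ (s ⟨m, hm⟩)
      refine ⟨s - u, by simpa [sub_sub_eq_add_sub, add_sub_right_comm] using L.add_mem hs hu,
        fun j hj => ?_⟩
      rcases Nat.lt_succ_iff_lt_or_eq.1 hj with hj | hj
      · rw [Pi.sub_apply, hu0 j hj, sub_zero]
        exact hP j hj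
      · obtain rfl : j = ⟨m, hm⟩ := Fin.ext hj
        rwa [Pi.sub_apply, huj, sub_sub_cancel]
  obtain ⟨s, hs, hP⟩ := key n le_rfl
  exact ⟨s, hs, fun j => hP j j.2⟩

/-- Reduction by `L` does not leave `K`, so the normal form of an element of `K` is zero and the
element lies in `L`. -/
theorem range_eq_of_reduced {L K : Submodule A (Fin n → A)} (hLK : L ≤ K) (P : Fin n → A → Prop)
    (h : ∀ j r, ∃ s, r - s ∈ leadIdeal L j ∧ P j s)
    (hK : ∀ s ∈ K, (∀ j, P j (s j)) → s = 0) : L = K := by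
  refine le_antisymm hLK fun v hv => ?_
  obtain ⟨s, hs, hP⟩ := exists_reduced L P h v
  have : s = 0 := hK s (by simpa using K.sub_mem hv (hLK hs)) hP
  simpa [this] using hs

end LeadIdeal

/-! ### Normal forms, and exactness for `∂₁`, `∂₂`, `∂₃`. -/

/-- Representatives of `R` modulo `(y, a, b)`. -/
def IsRedYAB (s : R k) : Prop :=
  (∃ p : k, cF s = C (C p)) ∧ (∃ q : k, cG s = C q) ∧ cH s = 0 ∧ cS s = 0
/-- Representatives of `R` modulo `(x, a, b)`. -/
def IsRedXAB (s : R k) : Prop :=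
  (∃ p : k, cF s = C (C p)) ∧ cG s = 0 ∧ (∃ q : k, cH s = C q) ∧ cS s = 0
/-- Representatives of `R` modulo `(x, y, a, b)`. -/
def IsRedXYAB (s : R k) : Prop :=
  (∃ p : k, cF s = C (C p)) ∧ cG s = 0 ∧ cH s = 0 ∧ cS s = 0
/-- Representatives of `R` modulo `(x, b)`. -/
def IsRedXB (s : R k) : Prop := (∃ f : k[X], cF s = C f) ∧ cG s = 0 ∧ cS s = 0
/-- Representatives of `R` modulo `(x)`. -/
def IsRedX (s : R k) : Prop := cG s = 0 ∧ cS s = 0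
/-- Representatives of `R` modulo `(y, a)`. -/
def IsRedYA (s : R k) : Prop :=
  (∃ f : k[X], cF s = f.map C) ∧ (∃ q : k, cG s = C q) ∧ cH s = 0 ∧ cS s = 0
/-- Representatives of `R` modulo `(x²)`. -/
def IsRedXX (s : R k) : Prop := cS s = 0
/-- Representatives of `R` modulo `(ax, ay, x²)`. -/
def IsRedAXAYXX (s : R k) : Prop := (∃ q : k, cG s = C q) ∧ (∃ q : k, cH s = C q) ∧ cS s = 0

theorem C_add_X_mul_eq_zero {A : Type*} [CommRing A] {c : A} {p : A[X]}
    (h : C c + X * p = 0) : c = 0 ∧ p = 0 := by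
  have hc : c = 0 := by simpa using congrArg (coeff · 0) h
  refine ⟨hc, ?_⟩
  rw [hc, C_0, zero_add] at h
  ext n
  simpa using congrArg (coeff · (n + 1)) h

theorem aug_apply (v : Fin 2 → R k) : aug k v = a k * v 0 + b k * v 1 := by
  simp [aug, Fintype.linearCombination_apply, Fin.sum_univ_two, mul_comm]

/-- Each vector given to `mem_leadIdeal` is a combination of columns whose entries above row `j`
cancel, leaving a generator of the leading ideal in row `j`. For a reduced kernel vector, comparing
coordinates in the equation kills the remaining unknowns. The later exactness proofs have the same
two halves. -/
theorem range_d1 : LinearMap.range (d1 k).mulVecLin = LinearMap.ker (aug k) := by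
  refine range_eq_of_reduced ?_ ![IsRedXB, IsRedX] ?_ ?_
  · rintro _ ⟨w, rfl⟩
    rw [LinearMap.mem_ker, aug_apply, Matrix.mulVecLin_apply, d1, mat1_mulVec]
    simp only [Matrix.cons_val_zero, Matrix.cons_val_one]
    linear_combination w 0 * a_mul_x (k := k) + w 1 * b_mul_x (k := k)
  · intro j r
    fin_cases j
    · exact exists_reduced_xb
        (mem_leadIdeal ![1, 0, 0] (by simp) (by simp [d1, mat1_mulVec]))
        (mem_leadIdeal ![0, 0, 1] (by simp) (by simp [d1, mat1_mulVec])) r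
    · exact exists_reduced_x
        (mem_leadIdeal ![0, 1, 0] (by simp [d1, mat1_mulVec]) (by simp [d1, mat1_mulVec])) r
  · intro s hs hP
    rw [LinearMap.mem_ker, aug_apply] at hs
    obtain ⟨⟨f, hf⟩, hG0, hS0⟩ : IsRedXB (s 0) := hP 0
    obtain ⟨hG1, hS1⟩ : IsRedX (s 1) := hP 1
    have eF := congrArg cF hs
    have eG := congrArg cG hs
    have eH := congrArg cH hs
    simp only [map_add, map_zero, cF_a_mul, cF_b_mul, hf, ← C_mul] at eF
    simp [hG0] at eG
    simp at eH
    obtain ⟨hf0, hF1⟩ := C_add_X_mul_eq_zero eF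
    have hf0 : f = 0 := by simpa using hf0
    funext j
    fin_cases j
    · exact ext_coord (by simp [hf, hf0]) (by simp [hG0]) (by simp [eH]) (by simp [hS0])
    · exact ext_coord (by simp [hF1]) (by simp [hG1]) (by simp [eG]) (by simp [hS1])

theorem eq_zero_of_coord {r : R k} (hF : cF r = 0) (hG : cG r = 0) (hH : cH r = 0)
    (hS : cS r = 0) : r = 0 :=
  ext_coord (by rw [hF, map_zero]) (by rw [hG, map_zero]) (by rw [hH, map_zero])
    (by rw [hS, map_zero])

theorem range_d2 : LinearMap.range (d2 k).mulVecLin = LinearMap.ker (d1 k).mulVecLin := by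
  refine range_eq_of_reduced ?_ ![IsRedYAB, IsRedYAB, IsRedXX] ?_ ?_
  · rintro _ ⟨w, rfl⟩
    exact mat1_mul_mat2 b_mul_x x_mul_y a_mul_x x_mul_x w
  · intro j r
    fin_cases j
    · exact exists_reduced_yab
        (mem_leadIdeal ![1, 0, 0, 0, 0, 0]
          (by simp) (by simp [d2, mat2_mulVec]))
        (mem_leadIdeal ![0, 0, 0, 0, 0, -1]
          (by simp) (by simp [d2, mat2_mulVec]; ring))
        (mem_leadIdeal ![0, 0, 0, 0, -1, 0]
          (by simp) (by simp [d2, mat2_mulVec]; ring)) r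
    · exact exists_reduced_yab
        (mem_leadIdeal ![0, 1, 0, 0, 0, 0]
          (by simp [d2, mat2_mulVec]) (by simp [d2, mat2_mulVec]))
        (mem_leadIdeal ![0, 0, 1, 0, 1, 0]
          (by simp [d2, mat2_mulVec]) (by simp [d2, mat2_mulVec]))
        (mem_leadIdeal ![0, 0, 0, 1, 0, 0]
          (by simp [d2, mat2_mulVec]) (by simp [d2, mat2_mulVec])) r
    · exact exists_reduced_xx
        -- Multiplying column 4 by `x` kills its entry `-b` and turns its entry `x` into `x²`.
        (mem_leadIdeal ![0, 0, 0, 0, x k, 0]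
          (by simp [Fin.forall_fin_succ, d2, mat2_mulVec]; grind [b_mul_x, a_mul_x, x_mul_x, x_mul_y])
          (by simp [d2, mat2_mulVec])) r
  · intro s hs hP
    rw [LinearMap.mem_ker, Matrix.mulVecLin_apply, d1, mat1_mulVec] at hs
    have e0 : x k * s 0 + b k * s 2 = 0 := congrFun hs 0
    have e1 : -(y k * s 0) + x k * s 1 - a k * s 2 = 0 := congrFun hs 1
    obtain ⟨⟨p0, hF0⟩, ⟨q0, hG0⟩, hH0, hS0⟩ : IsRedYAB (s 0) := hP 0
    obtain ⟨⟨p1, hF1⟩, ⟨q1, hG1⟩, hH1, hS1⟩ : IsRedYAB (s 1) := hP 1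
    have hS2 : cS (s 2) = 0 := hP 2
    have hF2 : cF (s 2) = 0 := by simpa using congrArg cF e0
    obtain ⟨hp0, hH2⟩ := C_add_X_mul_eq_zero (c := p0) (p := cH (s 2))
      (by simpa [hF0] using congrArg cG e0)
    have hq0 : q0 = 0 := by simpa [hG0] using congrArg cS e0
    obtain ⟨hp1, hG2⟩ := C_add_X_mul_eq_zero (c := p1) (p := -cG (s 2))
      (by simpa [hF0, hF1, hp0, coeff_C, sub_eq_add_neg] using congrArg cG e1)
    have hq1 : q1 = 0 := by simpa [hG1, hH0] using congrArg cS e1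
    rw [hp0, C_0, C_0] at hF0
    rw [hp1, C_0, C_0] at hF1
    rw [hq0, C_0] at hG0
    rw [hq1, C_0] at hG1
    funext j
    fin_cases j
    exacts [eq_zero_of_coord hF0 hG0 hH0 hS0, eq_zero_of_coord hF1 hG1 hH1 hS1,
      eq_zero_of_coord hF2 (neg_eq_zero.1 hG2) hH2 hS2]

theorem range_d3 : LinearMap.range (d3 k).mulVecLin = LinearMap.ker (d2 k).mulVecLin := by
  refine range_eq_of_reduced ?_ ![IsRedXAB, IsRedXAB, IsRedXB, IsRedX, IsRedYA, IsRedXX] ?_ ?_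
  · rintro _ ⟨w, rfl⟩
    exact mat2_mul_mat3 b_mul_x x_mul_y a_mul_x x_mul_x w
  · intro j r
    fin_cases j
    · exact exists_reduced_xab
        (mem_leadIdeal ![1, 0, 0, 0, 0, 0, 0, 0, 0, 0, 0]
          (by simp) (by simp [d3, mat3_mulVec]))
        (mem_leadIdeal ![0, 0, 0, 0, 0, 0, 0, 0, 1, 0, 0]
          (by simp) (by simp [d3, mat3_mulVec]))
        (mem_leadIdeal ![0, 0, 0, 0, 0, 0, 0, 1, 0, 0, 0]
          (by simp) (by simp [d3, mat3_mulVec])) r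
    · exact exists_reduced_xab
        (mem_leadIdeal ![0, 1, 0, 0, 0, 0, 0, 0, 0, 0, 0]
          (by simp [d3, mat3_mulVec]) (by simp [d3, mat3_mulVec]))
        (mem_leadIdeal ![0, 0, 0, -1, 0, 0, 0, -1, 0, 0, 0]
          (by simp [d3, mat3_mulVec]) (by simp [d3, mat3_mulVec]; ring))
        (mem_leadIdeal ![0, 0, 0, 0, 0, -1, 0, 0, 0, 0, 0]
          (by simp [d3, mat3_mulVec]) (by simp [d3, mat3_mulVec]; ring)) r
    · exact exists_reduced_xb
        (mem_leadIdeal ![0, 0, 1, 0, 0, -1, 0, 0, 0, 0, 0]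
          (by simp [Fin.forall_fin_succ, d3, mat3_mulVec]; ring) (by simp [d3, mat3_mulVec]))
        (mem_leadIdeal ![0, 0, 0, 0, 0, 0, 0, 0, 0, 0, 1]
          (by simp [Fin.forall_fin_succ, d3, mat3_mulVec]) (by simp [d3, mat3_mulVec])) r
    · exact exists_reduced_x
        (mem_leadIdeal ![0, 0, 0, 0, 1, 0, 0, 0, 0, 0, 0]
          (by simp [Fin.forall_fin_succ, d3, mat3_mulVec]) (by simp [d3, mat3_mulVec])) r
    · exact exists_reduced_ya
        (mem_leadIdeal ![0, 0, 0, 0, 0, 0, 1, -1, 0, 0, 0]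
          (by simp [Fin.forall_fin_succ, d3, mat3_mulVec]; ring) (by simp [d3, mat3_mulVec]))
        (mem_leadIdeal ![0, 0, 0, 0, 0, 0, 0, 0, 0, 1, 0]
          (by simp [Fin.forall_fin_succ, d3, mat3_mulVec]) (by simp [d3, mat3_mulVec])) r
    · exact exists_reduced_xx
        (mem_leadIdeal ![0, 0, 0, 0, 0, 0, 0, x k, 0, 0, 0]
          (by simp [Fin.forall_fin_succ, d3, mat3_mulVec]; grind [b_mul_x, a_mul_x, x_mul_x, x_mul_y])
          (by simp [d3, mat3_mulVec])) r
  · intro s hs hP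
    rw [LinearMap.mem_ker, Matrix.mulVecLin_apply, d2, mat2_mulVec] at hs
    have e0 : y k * s 0 + b k * s 2 - b k * s 4 - a k * s 5 = 0 := congrFun hs 0
    have e1 : x k * s 0 + y k * s 1 + a k * s 2 + b k * s 3 = 0 := congrFun hs 1
    have e2 : x k * s 4 + y k * s 5 = 0 := congrFun hs 2
    obtain ⟨⟨p0, hF0⟩, hG0, ⟨q0, hH0⟩, hS0⟩ : IsRedXAB (s 0) := hP 0
    obtain ⟨⟨p1, hF1⟩, hG1, ⟨q1, hH1⟩, hS1⟩ : IsRedXAB (s 1) := hP 1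
    obtain ⟨⟨f2, hF2⟩, hG2, hS2⟩ : IsRedXB (s 2) := hP 2
    obtain ⟨hG3, hS3⟩ : IsRedX (s 3) := hP 3
    obtain ⟨⟨f4, hF4⟩, ⟨q4, hG4⟩, hH4, hS4⟩ : IsRedYA (s 4) := hP 4
    have hS5 : cS (s 5) = 0 := hP 5
    obtain ⟨hf2, hF3⟩ := C_add_X_mul_eq_zero (c := X * f2) (p := cF (s 3))
      (by simpa [hF2] using congrArg cF e1)
    obtain rfl : f2 = 0 := by simpa using hf2
    obtain ⟨hp0, hH3⟩ := C_add_X_mul_eq_zero (c := p0) (p := cH (s 3))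
      (by simpa [hF0, hF1, hG2, coeff_C] using congrArg cG e1)
    obtain ⟨hp1, hH2⟩ := C_add_X_mul_eq_zero (c := p1) (p := cH (s 2))
      (by simpa [hF1] using congrArg cH e1)
    have hq1 : q1 = 0 := by simpa [hG0, hH1] using congrArg cS e1
    have eF : X * f4.map C + C X * cF (s 5) = 0 := by
      have := congrArg cF e0
      simp [hF2, hF4] at this
      linear_combination -this
    -- At `a = 0` the equation `b · f4(b) + a · cF (s 5) = 0` reduces to `b · f4(b) = 0`.
    have hf4 : f4 = 0 := by
      ext n
      have := congrArg (fun f => (coeff f (n + 1)).coeff 0) eF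
      simpa using this
    have hF5 : cF (s 5) = 0 := by simpa [hf4] using eF
    have hG5 : cG (s 5) = 0 := by simpa [hF0, hH2, hH4, coeff_C] using congrArg cG e0
    obtain ⟨-, hH5⟩ := C_add_X_mul_eq_zero (c := p0) (p := -cH (s 5))
      (by simpa [hF0, sub_eq_add_neg] using congrArg cH e0)
    have hq0 : q0 = 0 := by simpa [hH0] using congrArg cS e0
    have hH5 : cH (s 5) = 0 := neg_eq_zero.1 hH5
    have hq4 : q4 = 0 := by simpa [hG4, hH5] using congrArg cS e2
    rw [hp0, C_0, C_0] at hF0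
    rw [hp1, C_0, C_0] at hF1
    rw [hq0, C_0] at hH0
    rw [hq1, C_0] at hH1
    rw [C_0] at hF2
    rw [hf4, Polynomial.map_zero] at hF4
    rw [hq4, C_0] at hG4
    funext j
    fin_cases j
    exacts [eq_zero_of_coord hF0 hG0 hH0 hS0, eq_zero_of_coord hF1 hG1 hH1 hS1,
      eq_zero_of_coord hF2 hG2 hH2 hS2, eq_zero_of_coord hF3 hG3 hH3 hS3,
      eq_zero_of_coord hF4 hG4 hH4 hS4, eq_zero_of_coord hF5 hG5 hH5 hS5]

end BadAlgebra

/-! ### Exactness for `∂₄` when `2` is invertible. -/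

namespace BadAlgebra

open Polynomial

variable {k : Type*} [Field k]

/-- Normal forms of the coordinates modulo the columns of `∂₄`. -/
abbrev redD4 : Fin 11 → R k → Prop :=
  ![IsRedYAB, IsRedYAB, IsRedYAB, IsRedXB, IsRedYAB, IsRedXB, IsRedXYAB, IsRedAXAYXX, IsRedXX,
    IsRedXX, IsRedXX]

-- Division by two is needed for one leading entry only, namely `x²` at position 7.
set_option maxHeartbeats 1000000 in
theorem exists_redD4 (h2 : (2 : k) ≠ 0) (j : Fin 11) (r : R k) :
    ∃ s, r - s ∈ leadIdeal (LinearMap.range (d4 k).mulVecLin) j ∧ redD4 j s := by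
  obtain ⟨c, hc⟩ : ∃ c : R k, 2 * c = 1 := ⟨algebraMap k (R k) 2⁻¹, by
    rw [← map_ofNat (algebraMap k (R k)) 2, ← map_mul, mul_inv_cancel₀ h2, map_one]⟩
  fin_cases j
  · exact exists_reduced_yab
      (mem_leadIdeal ![1, 0, 0, 0, 0, 0, 0, 0, 0, 0, 0, 0, 0, 0, 0, 0, 0, 0, 0, 0]
        (by simp) (by simp [d4, mat4_mulVec]))
      (mem_leadIdeal ![0, 0, 0, 0, 0, 0, -1, 0, 0, 0, 0, 0, 0, 0, 0, 0, 0, 0, 0, 0]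
        (by simp) (by simp [d4, mat4_mulVec]; ring))
      (mem_leadIdeal ![0, 0, 0, 0, 0, 0, 0, 0, 0, -1, 0, 0, 0, 0, 0, 0, 0, 0, 0, 0]
        (by simp) (by simp [d4, mat4_mulVec]; ring)) r
  · exact exists_reduced_yab
      (mem_leadIdeal ![0, 1, 0, 0, 0, 0, 0, 0, 0, 0, 0, 0, 0, 0, 0, 0, 0, 0, 0, 0]
        (by simp [d4, mat4_mulVec]) (by simp [d4, mat4_mulVec]))
      (mem_leadIdeal ![0, 0, 1, 0, 0, 0, 0, 0, 0, 1, 0, 0, 0, 0, 0, 0, 0, 0, 0, 0]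
        (by simp [d4, mat4_mulVec]) (by simp [d4, mat4_mulVec]))
      (mem_leadIdeal ![0, 0, 0, 1, 0, 0, 0, 0, 0, 0, 0, 0, 0, 0, 0, 0, 0, 0, 0, 0]
        (by simp [d4, mat4_mulVec]) (by simp [d4, mat4_mulVec])) r
  · exact exists_reduced_yab
      (mem_leadIdeal ![0, 0, 0, 0, 1, 0, 0, 0, 0, -1, 0, 0, 0, 0, 0, 0, 0, 0, 0, 0]
        (by simp [Fin.forall_fin_succ, d4, mat4_mulVec]; ring) (by simp [d4, mat4_mulVec]))
      (mem_leadIdeal ![0, 0, 0, 0, 0, 0, 0, 0, 0, 0, 0, 0, 0, 0, 0, 0, 1, 0, 0, 0]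
        (by simp [Fin.forall_fin_succ, d4, mat4_mulVec]) (by simp [d4, mat4_mulVec]))
      (mem_leadIdeal ![0, 0, 0, 0, 0, 0, 0, 0, 0, 0, 0, 0, 0, 0, 0, -1, 0, 0, 0, 0]
        (by simp [Fin.forall_fin_succ, d4, mat4_mulVec]) (by simp [d4, mat4_mulVec]; ring)) r
  · exact exists_reduced_xb
      (mem_leadIdeal ![0, 0, 0, 0, 0, 1, 0, 0, 0, -1, 0, 0, 0, 0, 0, 0, 0, 0, 0, 0]
        (by simp [Fin.forall_fin_succ, d4, mat4_mulVec]; ring) (by simp [d4, mat4_mulVec]))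
      (mem_leadIdeal ![0, 0, 0, 0, 0, 0, 0, 0, 0, 0, 0, 0, 0, 0, 0, 0, 0, 0, 0, -1]
        (by simp [Fin.forall_fin_succ, d4, mat4_mulVec]) (by simp [d4, mat4_mulVec]; ring)) r
  · exact exists_reduced_yab
      (mem_leadIdeal ![0, 0, 0, 0, 0, 0, 0, 1, 0, 0, 0, 0, 0, 0, 0, 0, 0, 0, 0, 0]
        (by simp [Fin.forall_fin_succ, d4, mat4_mulVec]) (by simp [d4, mat4_mulVec]))
      (mem_leadIdeal ![0, 0, 0, 0, 0, 0, 0, 0, 0, 0, 0, 0, 0, 0, 0, 0, 0, 0, 1, 0]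
        (by simp [Fin.forall_fin_succ, d4, mat4_mulVec]) (by simp [d4, mat4_mulVec]))
      (mem_leadIdeal ![0, 0, 0, 0, 0, 0, 0, 0, 0, 0, 0, 0, 1, 0, 0, 0, 0, 0, 0, 0]
        (by simp [Fin.forall_fin_succ, d4, mat4_mulVec]) (by simp [d4, mat4_mulVec])) r
  · exact exists_reduced_xb
      (mem_leadIdeal ![0, 0, 0, 0, 0, 0, 0, 0, 1, 0, 0, 0, 0, 0, 0, 0, 0, 0, 0, 0]
        (by simp [Fin.forall_fin_succ, d4, mat4_mulVec]) (by simp [d4, mat4_mulVec]))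
      (mem_leadIdeal ![0, 0, 0, 0, 0, 0, 0, 0, 0, 0, 0, 0, 0, 1, 0, -1, 0, 0, 1, 0]
        (by simp [Fin.forall_fin_succ, d4, mat4_mulVec]; ring) (by simp [d4, mat4_mulVec])) r
  · exact exists_reduced_xyab
      (mem_leadIdeal ![0, 0, 0, 0, 0, 0, 0, 0, 0, 0, 1, 0, 0, 0, 0, 0, 0, 0, 0, 0]
        (by simp [Fin.forall_fin_succ, d4, mat4_mulVec]) (by simp [d4, mat4_mulVec]))
      (mem_leadIdeal ![0, 0, 0, 0, 0, 0, 0, 0, 0, 0, 0, 1, 0, 0, 0, 0, 0, 0, 0, 0]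
        (by simp [Fin.forall_fin_succ, d4, mat4_mulVec]) (by simp [d4, mat4_mulVec]))
      (mem_leadIdeal ![0, 0, 0, 0, 0, 0, 0, 0, 0, 0, 0, 0, 0, 0, 0, 0, 0, -1, 0, 0]
        (by simp [Fin.forall_fin_succ, d4, mat4_mulVec]) (by simp [d4, mat4_mulVec]; ring))
      (mem_leadIdeal ![0, 0, 0, 0, 0, 0, 0, 0, 0, 0, 0, 0, 0, 0, -1, 0, -1, 0, 0, 0]
        (by simp [Fin.forall_fin_succ, d4, mat4_mulVec]) (by simp [d4, mat4_mulVec]; ring)) r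
  · exact exists_reduced_ax_ay_xx
      (mem_leadIdeal ![0, 0, 0, 0, 0, 0, 0, 0, 0, 0, 0, 0, 0, 0, 0, -x k, 0, 0, 0, 0]
        (by simp [Fin.forall_fin_succ, d4, mat4_mulVec]; grind [b_mul_x, a_mul_x, x_mul_x, x_mul_y])
        (by simp [d4, mat4_mulVec]; grind [b_mul_x, a_mul_x, x_mul_x, x_mul_y]))
      -- The multiple of column 16 cancels `by` in row 2, since `ax = by`; row 7 keeps `ay`.
      (mem_leadIdeal ![0, 0, 0, 0, 0, 0, 0, 0, 0, 0, 0, 0, 0, 0, 0, -y k, -x k, 0, 0, 0]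
        (by simp [Fin.forall_fin_succ, d4, mat4_mulVec]; grind [b_mul_x, a_mul_x, x_mul_x, x_mul_y])
        (by simp [d4, mat4_mulVec]; grind [b_mul_x, a_mul_x, x_mul_x, x_mul_y]))
      -- Row 6 gives `c(x² - y²) = 0` and row 7 gives `2cy² = x²`.
      (mem_leadIdeal ![0, 0, 0, 0, 0, 0, 0, 0, 0, 0, c * x k, -(c * y k), 0, 0, 0, 0, 0, 0, 0, 0]
        (by simp [Fin.forall_fin_succ, d4, mat4_mulVec]; grind [b_mul_x, a_mul_x, x_mul_x, x_mul_y])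
        (by simp [d4, mat4_mulVec]; grind [b_mul_x, a_mul_x, x_mul_x, x_mul_y])) r
  · exact exists_reduced_xx
      (mem_leadIdeal ![0, 0, 0, 0, 0, 0, 0, 0, 0, 0, 0, x k, 0, 0, 0, 0, 0, 0, 0, 0]
        (by simp [Fin.forall_fin_succ, d4, mat4_mulVec]; grind [b_mul_x, a_mul_x, x_mul_x, x_mul_y])
        (by simp [d4, mat4_mulVec])) r
  · exact exists_reduced_xx
      (mem_leadIdeal ![0, 0, 0, 0, 0, 0, 0, 0, 0, 0, 0, 0, 0, 0, x k, 0, x k, 0, 0, 0]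
        (by simp [Fin.forall_fin_succ, d4, mat4_mulVec]; grind [b_mul_x, a_mul_x, x_mul_x, x_mul_y])
        (by simp [d4, mat4_mulVec])) r
  · exact exists_reduced_xx
      (mem_leadIdeal ![0, 0, 0, 0, 0, 0, 0, 0, 0, 0, 0, 0, 0, x k, 0, 0, 0, 0, x k, 0]
        (by simp [Fin.forall_fin_succ, d4, mat4_mulVec]; grind [b_mul_x, a_mul_x, x_mul_x, x_mul_y])
        (by simp [d4, mat4_mulVec])) r

-- This half is free of the characteristic: the invertibility of `2` matters for reaching the normal
-- form, not for showing that a reduced kernel vector vanishes.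
set_option maxHeartbeats 1000000 in
theorem eq_zero_of_redD4 {s : Fin 11 → R k} (hs : s ∈ LinearMap.ker (d3 k).mulVecLin)
    (hP : ∀ j, redD4 j (s j)) : s = 0 := by
  rw [LinearMap.mem_ker, Matrix.mulVecLin_apply, d3, mat3_mulVec] at hs
  have e0 : x k * s 0 - b k * s 3 + b k * s 6 + b k * s 7 + a k * s 8 = 0 := congrFun hs 0
  have e1 : -(y k * s 0) + x k * s 1 - b k * s 2 - a k * s 3 - b k * s 5 - b k * s 8 = 0 :=
    congrFun hs 1
  have e2 : x k * s 2 + y k * s 3 + b k * s 10 = 0 := congrFun hs 2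
  have e3 : x k * s 4 + y k * s 5 - a k * s 10 = 0 := congrFun hs 3
  have e4 : y k * s 6 - x k * s 8 + a k * s 9 + b k * s 10 = 0 := congrFun hs 4
  have e5 : x k * s 7 + y k * s 8 - b k * s 9 = 0 := congrFun hs 5
  obtain ⟨⟨p0, hF0⟩, ⟨q0, hG0⟩, hH0, hS0⟩ : IsRedYAB (s 0) := hP 0
  obtain ⟨⟨p1, hF1⟩, ⟨q1, hG1⟩, hH1, hS1⟩ : IsRedYAB (s 1) := hP 1
  obtain ⟨⟨p2, hF2⟩, ⟨q2, hG2⟩, hH2, hS2⟩ : IsRedYAB (s 2) := hP 2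
  obtain ⟨⟨f3, hF3⟩, hG3, hS3⟩ : IsRedXB (s 3) := hP 3
  obtain ⟨⟨p4, hF4⟩, ⟨q4, hG4⟩, hH4, hS4⟩ : IsRedYAB (s 4) := hP 4
  obtain ⟨⟨f5, hF5⟩, hG5, hS5⟩ : IsRedXB (s 5) := hP 5
  obtain ⟨⟨p6, hF6⟩, hG6, hH6, hS6⟩ : IsRedXYAB (s 6) := hP 6
  obtain ⟨⟨q7, hG7⟩, ⟨r7, hH7⟩, hS7⟩ : IsRedAXAYXX (s 7) := hP 7
  have hS8 : cS (s 8) = 0 := hP 8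
  have hS9 : cS (s 9) = 0 := hP 9
  have hS10 : cS (s 10) = 0 := hP 10
  have hF10 : cF (s 10) = 0 := by simpa using congrArg cF e2
  obtain ⟨hp2, hH10⟩ := C_add_X_mul_eq_zero (c := p2) (p := cH (s 10))
    (by simpa [hF2, hF3, coeff_C] using congrArg cG e2)
  have hf3 : f3 = 0 := by simpa [hF3] using congrArg cH e2
  obtain ⟨hp4, hG10⟩ := C_add_X_mul_eq_zero (c := p4) (p := -cG (s 10))
    (by simpa [hF4, hF5, coeff_C, sub_eq_add_neg] using congrArg cG e3)
  have hf5 : f5 = 0 := by simpa [hF5, hH10] using congrArg cH e3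
  rw [hp2, C_0, C_0] at hF2
  rw [hp4, C_0, C_0] at hF4
  rw [hf3, C_0] at hF3
  rw [hf5, C_0] at hF5
  have hF9 : cF (s 9) = 0 := by simpa [hF10] using congrArg cF e4
  obtain ⟨hp6, hH9⟩ := C_add_X_mul_eq_zero (c := p6) (p := cH (s 9))
    (by simpa [hF6] using congrArg cH e4)
  rw [hp6, C_0, C_0] at hF6
  have hG8 : (cG (s 8)).coeff 0 = 0 := by simpa [hH6] using congrArg cS e4
  have hF8 : cF (s 8) = 0 := by simpa [hF2, hF3, hF5] using congrArg cF e1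
  obtain ⟨hp1, hH58⟩ := C_add_X_mul_eq_zero (c := p1) (p := -cH (s 5) - cH (s 8)) (by
    have := congrArg cG e1
    simp [hF0, hF1, hH2, hG3, coeff_C] at this
    linear_combination this)
  obtain ⟨hp0, hH3⟩ := C_add_X_mul_eq_zero (c := p0) (p := cH (s 3)) (by
    have := congrArg cH e1
    simp [hF0] at this
    linear_combination -this)
  rw [hp0, C_0, C_0] at hF0
  rw [hp1, C_0, C_0] at hF1
  have hq1 : q1 = 0 := by simpa [hG1, hH0] using congrArg cS e1
  have hq2 : q2 = 0 := by simpa [hG2, hH3] using congrArg cS e2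
  have hG9 : cG (s 9) = 0 := by simpa [hF6, hF8, hH10] using congrArg cG e4
  have hF7 : cF (s 7) = 0 := by simpa [hF3, hF6, hF8] using congrArg cF e0
  have hG78 : C r7 + cG (s 8) = 0 := by
    have : X * C r7 + X * cG (s 8) = 0 := by
      simpa [hF0, hH3, hH6, hH7] using congrArg cG e0
    rw [← mul_add] at this
    simpa using this
  -- Row 4 has shown that `cG (s 8)` has no constant term, so the two summands separate.
  have hr7 : r7 = 0 := by simpa [hG8] using congrArg (coeff · 0) hG78
  have hH8 : cH (s 8) = 0 := by simpa using congrArg cH e0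
  have hH5 : cH (s 5) = 0 := by simpa [hH8] using hH58
  have hq4 : q4 = 0 := by simpa [hG4, hH5] using congrArg cS e3
  have hq0 : q0 = 0 := by simpa [hG0] using congrArg cS e0
  have hq7 : q7 = 0 := by simpa [hG7, hH8] using congrArg cS e5
  rw [hr7, C_0, zero_add] at hG78
  rw [hr7, C_0] at hH7
  rw [hq0, C_0] at hG0
  rw [hq1, C_0] at hG1
  rw [hq2, C_0] at hG2
  rw [hq4, C_0] at hG4
  rw [hq7, C_0] at hG7
  funext j
  fin_cases j
  exacts [eq_zero_of_coord hF0 hG0 hH0 hS0, eq_zero_of_coord hF1 hG1 hH1 hS1,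
    eq_zero_of_coord hF2 hG2 hH2 hS2, eq_zero_of_coord hF3 hG3 hH3 hS3,
    eq_zero_of_coord hF4 hG4 hH4 hS4, eq_zero_of_coord hF5 hG5 hH5 hS5,
    eq_zero_of_coord hF6 hG6 hH6 hS6, eq_zero_of_coord hF7 hG7 hH7 hS7,
    eq_zero_of_coord hF8 hG78 hH8 hS8, eq_zero_of_coord hF9 hG9 hH9 hS9,
    eq_zero_of_coord hF10 (neg_eq_zero.1 hG10) hH10 hS10]

theorem range_d4 (h2 : (2 : k) ≠ 0) :
    LinearMap.range (d4 k).mulVecLin = LinearMap.ker (d3 k).mulVecLin := by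
  refine range_eq_of_reduced ?_ redD4 (exists_redD4 h2) fun s => eq_zero_of_redD4
  rintro _ ⟨w, rfl⟩
  exact mat3_mul_mat4 b_mul_x x_mul_y a_mul_x x_mul_x w

end BadAlgebra

namespace BadAlgebra

open Polynomial

variable {k : Type*} [Field k]

/-! ### Coefficients of linear parts. -/

section LinearCoefficients

/-- The coefficient of `x` in the linear part. -/
noncomputable def lx (r : R k) : k := (cG r).coeff 0
/-- The coefficient of `y` in the linear part. -/
noncomputable def ly (r : R k) : k := (cH r).coeff 0
/-- The coefficient of `a` in the linear part. -/
noncomputable def la (r : R k) : k := ((cF r).coeff 0).coeff 1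
/-- The coefficient of `b` in the linear part. -/
noncomputable def lb (r : R k) : k := ((cF r).coeff 1).coeff 0

@[simp] theorem lx_zero : lx (0 : R k) = 0 := by simp [lx]
@[simp] theorem ly_zero : ly (0 : R k) = 0 := by simp [ly]
@[simp] theorem la_zero : la (0 : R k) = 0 := by simp [la]
@[simp] theorem lb_zero : lb (0 : R k) = 0 := by simp [lb]
@[simp] theorem lx_add (r s : R k) : lx (r + s) = lx r + lx s := by simp [lx]
@[simp] theorem ly_add (r s : R k) : ly (r + s) = ly r + ly s := by simp [ly]
@[simp] theorem la_add (r s : R k) : la (r + s) = la r + la s := by simp [la]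
@[simp] theorem lb_add (r s : R k) : lb (r + s) = lb r + lb s := by simp [lb]
@[simp] theorem lx_sub (r s : R k) : lx (r - s) = lx r - lx s := by simp [lx]
@[simp] theorem ly_sub (r s : R k) : ly (r - s) = ly r - ly s := by simp [ly]
@[simp] theorem la_sub (r s : R k) : la (r - s) = la r - la s := by simp [la]
@[simp] theorem lb_sub (r s : R k) : lb (r - s) = lb r - lb s := by simp [lb]
@[simp] theorem lx_neg (r : R k) : lx (-r) = -lx r := by simp [lx]
@[simp] theorem ly_neg (r : R k) : ly (-r) = -ly r := by simp [ly]
@[simp] theorem lx_x_mul (r : R k) : lx (x k * r) = ct r := by simp [lx, ct]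
@[simp] theorem ly_x_mul (r : R k) : ly (x k * r) = 0 := by simp [ly]
@[simp] theorem la_x_mul (r : R k) : la (x k * r) = 0 := by simp [la]
@[simp] theorem lb_x_mul (r : R k) : lb (x k * r) = 0 := by simp [lb]
@[simp] theorem lx_y_mul (r : R k) : lx (y k * r) = 0 := by simp [lx]
@[simp] theorem ly_y_mul (r : R k) : ly (y k * r) = ct r := by simp [ly, ct]
@[simp] theorem la_y_mul (r : R k) : la (y k * r) = 0 := by simp [la]
@[simp] theorem lb_y_mul (r : R k) : lb (y k * r) = 0 := by simp [lb]
@[simp] theorem lx_a_mul (r : R k) : lx (a k * r) = 0 := by simp [lx]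
@[simp] theorem ly_a_mul (r : R k) : ly (a k * r) = 0 := by simp [ly]
@[simp] theorem la_a_mul (r : R k) : la (a k * r) = ct r := by simp [la, ct]
@[simp] theorem lb_a_mul (r : R k) : lb (a k * r) = 0 := by simp [lb]
@[simp] theorem lx_b_mul (r : R k) : lx (b k * r) = 0 := by simp [lx]
@[simp] theorem ly_b_mul (r : R k) : ly (b k * r) = 0 := by simp [ly]
@[simp] theorem la_b_mul (r : R k) : la (b k * r) = 0 := by simp [la]
@[simp] theorem lb_b_mul (r : R k) : lb (b k * r) = ct r := by simp [lb, ct]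

end LinearCoefficients

/-! ### Minimality of the generators. -/

section Minimality

theorem mem_irr_smul_top {n : ℕ} {v : Fin n → R k} (hv : ∀ j, ct (v j) = 0) :
    v ∈ irr k • (⊤ : Submodule (R k) (Fin n → R k)) := by
  rw [pi_eq_sum_univ v]
  exact Submodule.sum_mem _ fun j _ =>
    Submodule.smul_mem_smul (mem_irr_iff.2 (hv j)) Submodule.mem_top

/-- The entries are linear forms, so the linear coefficients of each row of the product are
combinations of the constant terms of `v`. Suitable coefficients isolate all of them; the same works
for the other matrices. -/
theorem ct_eq_zero_of_d1 {v : Fin 3 → R k} (hv : (d1 k).mulVec v = 0) (j : Fin 3) :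
    ct (v j) = 0 := by
  rw [d1, mat1_mulVec] at hv
  have e0 : x k * v 0 + b k * v 2 = 0 := congrFun hv 0
  have e1 : -(y k * v 0) + x k * v 1 - a k * v 2 = 0 := congrFun hv 1
  have x0 := congrArg lx e0
  have b0 := congrArg lb e0
  have x1 := congrArg lx e1
  simp at x0 b0 x1
  fin_cases j <;> assumption

theorem ct_eq_zero_of_d2 {v : Fin 6 → R k} (hv : (d2 k).mulVec v = 0) (j : Fin 6) :
    ct (v j) = 0 := by
  rw [d2, mat2_mulVec] at hv
  have e0 : y k * v 0 + b k * v 2 - b k * v 4 - a k * v 5 = 0 := congrFun hv 0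
  have e1 : x k * v 0 + y k * v 1 + a k * v 2 + b k * v 3 = 0 := congrFun hv 1
  have y0 := congrArg ly e0
  have a0 := congrArg la e0
  have b0 := congrArg lb e0
  have y1 := congrArg ly e1
  have a1 := congrArg la e1
  have b1 := congrArg lb e1
  simp at y0 a0 b0 y1 a1 b1
  rw [a1, zero_sub, neg_eq_zero] at b0
  fin_cases j <;> assumption

theorem ct_eq_zero_of_d3 {v : Fin 11 → R k} (hv : (d3 k).mulVec v = 0) (j : Fin 11) :
    ct (v j) = 0 := by
  rw [d3, mat3_mulVec] at hv
  have e0 : x k * v 0 - b k * v 3 + b k * v 6 + b k * v 7 + a k * v 8 = 0 := congrFun hv 0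
  have e1 : -(y k * v 0) + x k * v 1 - b k * v 2 - a k * v 3 - b k * v 5 - b k * v 8 = 0 :=
    congrFun hv 1
  have e2 : x k * v 2 + y k * v 3 + b k * v 10 = 0 := congrFun hv 2
  have e3 : x k * v 4 + y k * v 5 - a k * v 10 = 0 := congrFun hv 3
  have e4 : y k * v 6 - x k * v 8 + a k * v 9 + b k * v 10 = 0 := congrFun hv 4
  have e5 : x k * v 7 + y k * v 8 - b k * v 9 = 0 := congrFun hv 5
  have h0 := congrArg lx e0
  have h8 := congrArg la e0
  have h1 := congrArg lx e1
  have h2 := congrArg lx e2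
  have h3 := congrArg ly e2
  have h10 := congrArg lb e2
  have h4 := congrArg lx e3
  have h5 := congrArg ly e3
  have h6 := congrArg ly e4
  have h9 := congrArg la e4
  have h7 := congrArg lx e5
  simp at h0 h1 h2 h3 h4 h5 h6 h7 h8 h9 h10
  fin_cases j <;> assumption

-- Row 7 is read only at `a` and `b`, never at its entries `2y` and `-2y`, so the characteristic
-- plays no role.
set_option maxHeartbeats 1000000 in
theorem ct_eq_zero_of_d4 {v : Fin 20 → R k} (hv : (d4 k).mulVec v = 0) (j : Fin 20) :
    ct (v j) = 0 := by
  rw [d4, mat4_mulVec] at hv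
  have e0 : y k * v 0 + b k * v 2 - b k * v 4 - b k * v 5 - a k * v 6 - b k * v 9 = 0 :=
    congrFun hv 0
  have e1 : x k * v 0 + y k * v 1 + a k * v 2 + b k * v 3 = 0 := congrFun hv 1
  have e2 : y k * v 4 - x k * v 6 - b k * v 13 - a k * v 14 - b k * v 15 + a k * v 16 = 0 :=
    congrFun hv 2
  have e3 : x k * v 5 + y k * v 6 + b k * v 14 - b k * v 16 - b k * v 19 = 0 := congrFun hv 3
  have e4 : y k * v 7 - x k * v 9 + b k * v 12 - a k * v 13 + a k * v 18 = 0 := congrFun hv 4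
  have e5 : x k * v 8 + y k * v 9 + b k * v 13 + a k * v 19 = 0 := congrFun hv 5
  have e6 : x k * v 10 + y k * v 11 - b k * v 16 - a k * v 17 - b k * v 19 = 0 := congrFun hv 6
  have e7 : 2 * (y k * v 6) - 2 * (y k * v 11) + b k * v 14 - a k * v 15 + a k * v 17 = 0 :=
    congrFun hv 7
  have e9 : x k * v 16 + y k * v 17 = 0 := congrFun hv 9
  have e10 : x k * v 18 + y k * v 19 = 0 := congrFun hv 10
  have h0 := congrArg ly e0
  have h6 := congrArg la e0
  have h1 := congrArg ly e1
  have h2 := congrArg la e1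
  have h3 := congrArg lb e1
  have h4 := congrArg ly e2
  have h5 := congrArg lx e3
  have h7 := congrArg ly e4
  have h9 := congrArg lx e4
  have h12 := congrArg lb e4
  have h8 := congrArg lx e5
  have h13 := congrArg lb e5
  have h10 := congrArg lx e6
  have h11 := congrArg ly e6
  have h14 := congrArg lb e7
  have h15 := congrArg la e7
  have h16 := congrArg lx e9
  have h17 := congrArg ly e9
  have h18 := congrArg lx e10
  have h19 := congrArg ly e10
  simp [two_mul] at h0 h1 h2 h3 h4 h5 h6 h7 h8 h9 h10 h11 h12 h13 h14 h15 h16 h17 h18 h19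
  rw [h17, add_zero, neg_eq_zero] at h15
  fin_cases j <;> assumption

theorem ct_eq_zero_of_aug {v : Fin 2 → R k} (hv : aug k v = 0) (j : Fin 2) : ct (v j) = 0 := by
  rw [aug_apply] at hv
  have h0 := congrArg la hv
  have h1 := congrArg lb hv
  simp at h0 h1
  fin_cases j <;> assumption

theorem range_aug : LinearMap.range (aug k) = Ideal.span {a k, b k} := by
  ext r
  rw [Ideal.mem_span_pair]
  constructor
  · rintro ⟨v, rfl⟩
    exact ⟨v 0, v 1, by rw [aug_apply]; ring⟩
  · rintro ⟨u, v, rfl⟩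
    exact ⟨![u, v], by simp [aug_apply, mul_comm]⟩

section Entries

variable {A : Type*} [CommRing A] {x y a b : A} (S : AddSubgroup A)

theorem mat1_mem (hx : x ∈ S) (hy : y ∈ S) (ha : a ∈ S) (hb : b ∈ S) (i : Fin 2) (j : Fin 3) :
    mat1 x y a b i j ∈ S := by
  fin_cases i <;> fin_cases j <;> simp [mat1, S.zero_mem, *]

theorem mat2_mem (hx : x ∈ S) (hy : y ∈ S) (ha : a ∈ S) (hb : b ∈ S) (i : Fin 3) (j : Fin 6) :
    mat2 x y a b i j ∈ S := by
  fin_cases i <;> fin_cases j <;> simp [mat2, S.zero_mem, *]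

theorem mat3_mem (hx : x ∈ S) (hy : y ∈ S) (ha : a ∈ S) (hb : b ∈ S) (i : Fin 6) (j : Fin 11) :
    mat3 x y a b i j ∈ S := by
  fin_cases i <;> fin_cases j <;> simp [mat3, S.zero_mem, *]

set_option maxHeartbeats 1000000 in
theorem mat4_mem (hx : x ∈ S) (hy : y ∈ S) (ha : a ∈ S) (hb : b ∈ S) (i : Fin 11) (j : Fin 20) :
    mat4 x y a b i j ∈ S := by
  have h2 : 2 * y ∈ S := by
    rw [two_mul]
    exact S.add_mem hy hy
  fin_cases i <;> fin_cases j <;> simp [mat4, S.zero_mem, *]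

end Entries

theorem isMinimalLinearCover_of {m n : ℕ} {N : Matrix (Fin m) (Fin n) (R k)}
    {K : Submodule (R k) (Fin m → R k)} (hN : ∀ i j, N i j ∈ gr k 1)
    (hK : LinearMap.range N.mulVecLin = K) (h0 : ∀ v, N.mulVec v = 0 → ∀ j, ct (v j) = 0) :
    IsMinimalLinearCover (gr k) N K :=
  ⟨hN, hK, fun v hv => mem_irr_smul_top (h0 v hv)⟩

theorem cover_aug : IsMinimalCover (gr k) (aug k) (Ideal.span {a k, b k}) :=
  ⟨range_aug, fun _ hv => mem_irr_smul_top (ct_eq_zero_of_aug hv)⟩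

theorem cover_d1 : IsMinimalLinearCover (gr k) (d1 k) (LinearMap.ker (aug k)) :=
  isMinimalLinearCover_of (mat1_mem (gr k 1).toAddSubgroup x_mem y_mem a_mem b_mem) range_d1
    fun _ => ct_eq_zero_of_d1

theorem cover_d2 : IsMinimalLinearCover (gr k) (d2 k) (LinearMap.ker (d1 k).mulVecLin) :=
  isMinimalLinearCover_of (mat2_mem (gr k 1).toAddSubgroup x_mem y_mem a_mem b_mem) range_d2
    fun _ => ct_eq_zero_of_d2

theorem cover_d3 : IsMinimalLinearCover (gr k) (d3 k) (LinearMap.ker (d2 k).mulVecLin) :=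
  isMinimalLinearCover_of (mat3_mem (gr k 1).toAddSubgroup x_mem y_mem a_mem b_mem) range_d3
    fun _ => ct_eq_zero_of_d3

theorem cover_d4 (h2 : (2 : k) ≠ 0) :
    IsMinimalLinearCover (gr k) (d4 k) (LinearMap.ker (d3 k).mulVecLin) :=
  isMinimalLinearCover_of (mat4_mem (gr k 1).toAddSubgroup x_mem y_mem a_mem b_mem) (range_d4 h2)
    fun _ => ct_eq_zero_of_d4

end Minimality

/-! ### Quadratic minimal syzygies. -/

section QuadraticSyzygies

/-- `R₊` is generated by the variables and `K` is a submodule, so an additive map need only be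
tested on products of one variable with elements of `K`. -/
theorem functional_eq_zero {n : ℕ} (K : Submodule (R k) (Fin n → R k)) (l : (Fin n → R k) →+ k)
    (h : ∀ t ∈ K, l (x k • t) = 0 ∧ l (y k • t) = 0 ∧ l (a k • t) = 0 ∧ l (b k • t) = 0)
    {s : Fin n → R k} (hs : s ∈ irr k • K) : l s = 0 := by
  rw [irr_eq_span] at hs
  refine Submodule.smul_induction_on hs (fun r hr t ht => ?_) fun u v hu hv => by
    rw [map_add, hu, hv, add_zero]
  obtain ⟨p, z, hz, rfl⟩ := Ideal.mem_span_insert.1 hr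
  obtain ⟨q, z, hz', rfl⟩ := Ideal.mem_span_insert.1 hz
  obtain ⟨u, z, hz'', rfl⟩ := Ideal.mem_span_insert.1 hz'
  obtain ⟨v, rfl⟩ := Ideal.mem_span_singleton'.1 hz''
  simp only [mul_comm p, mul_comm q, mul_comm u, mul_comm v, add_smul, mul_smul, map_add]
  rw [(h _ (K.smul_mem p ht)).1, (h _ (K.smul_mem q ht)).2.1, (h _ (K.smul_mem u ht)).2.2.1,
    (h _ (K.smul_mem v ht)).2.2.2]
  simp

theorem xx_mem : x k * x k ∈ gr k 2 := SetLike.mul_mem_graded (i := 1) (j := 1) x_mem x_mem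

theorem single_mem_gr {n : ℕ} (i : Fin n) (j : Fin n) :
    (Pi.single i (x k * x k) : Fin n → R k) j ∈ gr k 2 := by
  rcases eq_or_ne j i with rfl | h
  · simpa using xx_mem
  · simp [h]

theorem cG_x : cG (x k) = 1 := by
  rw [← mul_one (x k), cG_x_mul, ← map_one (algebraMap k (R k)), cF_algebraMap]
  simp

/-- The test functional is the coefficient of `x²` in coordinate 7. On multiples of a kernel element
`t` by `x` and `y` it reads the coefficients of `x` and `y` in `t 7`; the kernel equations make the
first zero and the second a multiple of `2`. -/
theorem hasMinimalQuadraticSyzygy_d3 (h2 : (2 : k) = 0) :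
    HasMinimalQuadraticSyzygy (gr k) (d3 k) := by
  refine ⟨Pi.single 7 (x k * x k), ?_, single_mem_gr 7, fun hs => ?_⟩
  · rw [LinearMap.mem_ker, Matrix.mulVecLin_apply, d3, mat3_mulVec]
    funext i
    fin_cases i <;> simp <;> grind [b_mul_x, x_mul_x_mul_x]
  · have h := functional_eq_zero _
      (((cS : R k →ₗ[k] k).toAddMonoidHom).comp (Pi.evalAddMonoidHom (fun _ : Fin 11 => R k) 7))
      (fun t ht => ?_) hs
    · simp [cG_x] at h
    rw [LinearMap.mem_ker, Matrix.mulVecLin_apply, d3, mat3_mulVec] at ht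
    have e0 : x k * t 0 - b k * t 3 + b k * t 6 + b k * t 7 + a k * t 8 = 0 := congrFun ht 0
    have e1 : -(y k * t 0) + x k * t 1 - b k * t 2 - a k * t 3 - b k * t 5 - b k * t 8 = 0 :=
      congrFun ht 1
    have e4 : y k * t 6 - x k * t 8 + a k * t 9 + b k * t 10 = 0 := congrFun ht 4
    have e5 : x k * t 7 + y k * t 8 - b k * t 9 = 0 := congrFun ht 5
    have hH8 : cH (t 8) = 0 := by simpa using congrArg cH e0
    have hG7 : (cG (t 7)).coeff 0 = 0 := by simpa [hH8] using congrArg cS e5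
    have c0 := congrArg (fun r => (cG r).coeff 1) e0
    have c1 := congrArg (fun r => (cH r).coeff 1) e1
    have c4 := congrArg cS e4
    simp at c0 c1 c4
    have hH7 : (cH (t 7)).coeff 0 = 0 := by
      linear_combination c0 + c1 - c4 + ((cH (t 3)).coeff 0 - (cG (t 8)).coeff 0) * h2
    simp [hG7, hH7]

/-- The coefficient of `x²` in coordinate 11 alone does not vanish on `y • t` for formal reasons:
the kernel equations equate the `y`-coefficient of `t 11` with that of `t 6`, and hence with the
`a`-coefficient of `t 0`. Subtracting the coefficient of `ay` in coordinate 0 compensates for this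
and does not see the syzygy `x²e₁₁`. -/
theorem hasMinimalQuadraticSyzygy_d4 (h2 : (2 : k) ≠ 0) :
    HasMinimalQuadraticSyzygy (gr k) (d4 k) := by
  refine ⟨Pi.single 11 (x k * x k), ?_, single_mem_gr 11, fun hs => ?_⟩
  · rw [LinearMap.mem_ker, Matrix.mulVecLin_apply, d4, mat4_mulVec]
    funext i
    fin_cases i <;> simp <;> grind [x_mul_y, x_mul_x_mul_x]
  · have h := functional_eq_zero _
      (((cS : R k →ₗ[k] k).toAddMonoidHom).comp (Pi.evalAddMonoidHom (fun _ : Fin 20 => R k) 11) -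
        ((Polynomial.lcoeff k 1).comp (cH : R k →ₗ[k] k[X])).toAddMonoidHom.comp
          (Pi.evalAddMonoidHom (fun _ : Fin 20 => R k) 0))
      (fun t ht => ?_) hs
    · simp [cG_x] at h
    rw [LinearMap.mem_ker, Matrix.mulVecLin_apply, d4, mat4_mulVec] at ht
    have e0 : y k * t 0 + b k * t 2 - b k * t 4 - b k * t 5 - a k * t 6 - b k * t 9 = 0 :=
      congrFun ht 0
    have e7 : 2 * (y k * t 6) - 2 * (y k * t 11) + b k * t 14 - a k * t 15 + a k * t 17 = 0 :=
      congrFun ht 7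
    have e8 : x k * t 11 + b k * t 15 = 0 := congrFun ht 8
    have hG11 : (cG (t 11)).coeff 0 = 0 := by simpa using congrArg cS e8
    have hH0 : (cH (t 0)).coeff 0 = 0 := by simpa using congrArg cS e0
    have c0 := congrArg (fun r => (cH r).coeff 1) e0
    have c7 := congrArg cS e7
    simp [two_mul] at c0 c7
    have hH11 : (cH (t 11)).coeff 0 - ((cF (t 0)).coeff 0).coeff 1 = 0 := by
      refine mul_left_cancel₀ h2 ?_
      linear_combination -c7 - 2 * c0
    simp [hG11, hH0, hH11]

end QuadraticSyzygies

/-! ### The algebra retract. -/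

section Retract

theorem exists_retract : ∃ (φ : R k →ₐ[k] R' k) (σ : R' k →ₐ[k] R k),
    φ (x k) = x' k ∧ φ (y k) = y' k ∧ φ (a k) = 0 ∧ φ (b k) = 0 ∧
    σ (x' k) = x k ∧ σ (y' k) = y k ∧ φ.comp σ = AlgHom.id k (R' k) ∧
    RingHom.ker φ = Ideal.span {a k, b k} := by
  have hxy : x' k * y' k = 0 :=
    Ideal.Quotient.eq_zero_iff_mem.2 (Ideal.subset_span (by simp))
  have hxx : x' k ^ 2 - y' k ^ 2 = 0 :=
    Ideal.Quotient.eq_zero_iff_mem.2 (Ideal.subset_span (by simp))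
  let φ : R k →ₐ[k] R' k := Ideal.Quotient.liftₐ _ (MvPolynomial.aeval ![x' k, y' k, 0, 0]) (by
    have hle : Ideal.span (relations k) ≤
        RingHom.ker (MvPolynomial.aeval (R := k) ![x' k, y' k, 0, 0]) := by
      refine Ideal.span_le.2 ?_
      rintro q (rfl | rfl | rfl | rfl) <;>
        simp [RingHom.mem_ker, hxy, hxx]
    exact fun p hp => hle hp)
  let σ : R' k →ₐ[k] R k := Ideal.Quotient.liftₐ _ (MvPolynomial.aeval ![x k, y k]) (by
    have hle : Ideal.span ({MvPolynomial.X 0 ^ 2 - MvPolynomial.X 1 ^ 2,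
        MvPolynomial.X 0 * MvPolynomial.X 1} : Set (MvPolynomial (Fin 2) k)) ≤
        RingHom.ker (MvPolynomial.aeval (R := k) ![x k, y k]) := by
      refine Ideal.span_le.2 ?_
      rintro q (rfl | rfl) <;>
        simp [RingHom.mem_ker, x_mul_y, pow_two, x_mul_x]
    exact fun p hp => hle hp)
  have hφ : ∀ i, φ (Ideal.Quotient.mk _ (MvPolynomial.X i)) = ![x' k, y' k, 0, 0] i := fun i =>
    MvPolynomial.aeval_X _ i
  have hσ : ∀ i, σ (Ideal.Quotient.mk _ (MvPolynomial.X i)) = ![x k, y k] i := fun i =>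
    MvPolynomial.aeval_X _ i
  have hker : ∀ r, r - σ (φ r) ∈ Ideal.span {a k, b k} := by
    intro r
    rw [← Ideal.Quotient.eq]
    -- Both sides are algebra maps from `R` to `R/U`, so the four variables decide.
    have h : Ideal.Quotient.mkₐ k (Ideal.span {a k, b k}) =
        (Ideal.Quotient.mkₐ k (Ideal.span {a k, b k})).comp (σ.comp φ) := by
      refine Ideal.Quotient.algHom_ext _ (MvPolynomial.algHom_ext fun i => ?_)
      have e : σ (φ (Ideal.Quotient.mk _ (MvPolynomial.X i))) = ![x k, y k, 0, 0] i := by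
        rw [hφ]
        fin_cases i
        exacts [hσ 0, hσ 1, map_zero σ, map_zero σ]
      change Ideal.Quotient.mk _ (Ideal.Quotient.mk _ (MvPolynomial.X i)) =
        Ideal.Quotient.mk _ (σ (φ (Ideal.Quotient.mk _ (MvPolynomial.X i))))
      rw [e, Ideal.Quotient.eq]
      fin_cases i
      · exact (sub_self (x k)).symm ▸ Ideal.zero_mem _
      · exact (sub_self (y k)).symm ▸ Ideal.zero_mem _
      · exact (sub_zero (a k)).symm ▸ Ideal.subset_span (by simp)
      · exact (sub_zero (b k)).symm ▸ Ideal.subset_span (by simp)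
    exact AlgHom.congr_fun h r
  refine ⟨φ, σ, hφ 0, hφ 1, hφ 2, hφ 3, hσ 0, hσ 1, ?_, le_antisymm (fun r hr => ?_) ?_⟩
  · refine Ideal.Quotient.algHom_ext _ (MvPolynomial.algHom_ext fun i => ?_)
    change φ (σ (Ideal.Quotient.mk _ (MvPolynomial.X i))) = Ideal.Quotient.mk _ (MvPolynomial.X i)
    rw [hσ]
    fin_cases i
    exacts [hφ 0, hφ 1]
  · have := hker r
    rwa [RingHom.mem_ker.1 hr, map_zero, sub_zero] at this
  · refine Ideal.span_le.2 ?_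
    rintro q (rfl | rfl)
    exacts [hφ 2, hφ 3]

end Retract

end BadAlgebra

namespace BadAlgebra

variable {k : Type*} [Field k]

/-! ### Homogeneous parts of vectors and dependent choice. -/

section Parts

theorem decompose_zero (r : R k) :
    (DirectSum.decompose (gr k) r 0 : R k) = algebraMap k (R k) (ct r) := by
  have h := span_le_irr (sub_ct_mem r)
  rw [HomogeneousIdeal.mem_iff, HomogeneousIdeal.mem_irrelevant_iff, GradedRing.proj_apply,
    DirectSum.decompose_sub, DirectSum.sub_apply, AddSubgroupClass.coe_sub,
    DirectSum.decompose_of_mem_same (gr k) (algebraMap_mem _), sub_eq_zero] at h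
  exact h

/-- A vector of constants. -/
noncomputable def cst {m : ℕ} (c : Fin m → k) : Fin m → R k := fun j => algebraMap k (R k) (c j)

/-- The coordinates are linear forms. -/
def IsLin {m : ℕ} (v : Fin m → R k) : Prop := ∀ j, v j ∈ gr k 1

variable {m n : ℕ}

theorem isLin_smul_cst {r : R k} (hr : r ∈ gr k 1) (c : Fin m → k) : IsLin (r • cst c) :=
  fun j => SetLike.mul_mem_graded (A := gr k) (i := 1) (j := 0) hr (algebraMap_mem (c j))

theorem IsLin.sum {ι : Type*} {s : Finset ι} {v : ι → Fin m → R k} (h : ∀ i, IsLin (v i)) :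
    IsLin (∑ i ∈ s, v i) := fun j => by
  rw [Finset.sum_apply]
  exact Submodule.sum_mem _ fun i _ => h i j

/-- A matrix of linear forms raises degree by exactly one, so only the degree-`d` part of a solution
contributes to a right-hand side of degree `1 + d`. -/
theorem decompose_mulVec {M : Matrix (Fin m) (Fin n) (R k)} (hM : ∀ i j, M i j ∈ gr k 1) {d : ℕ}
    {v : Fin m → R k} (hv : ∀ i, v i ∈ gr k (1 + d)) {w : Fin n → R k} (h : M.mulVec w = v) :
    M.mulVec (fun j => (DirectSum.decompose (gr k) (w j) d : R k)) = v := by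
  funext i
  rw [← DirectSum.decompose_of_mem_same (gr k) (hv i), ← h]
  simp only [Matrix.mulVec, dotProduct, DirectSum.decompose_sum, DirectSum.sum_apply,
    AddSubmonoidClass.coe_finsetSum]
  exact Finset.sum_congr rfl fun j _ =>
    (DirectSum.coe_decompose_mul_add_of_left_mem (gr k) (hM i j)).symm

theorem exists_cst_of_mulVec {M : Matrix (Fin m) (Fin n) (R k)} (hM : ∀ i j, M i j ∈ gr k 1)
    {v : Fin m → R k} (hv : IsLin v) {w : Fin n → R k} (h : M.mulVec w = v) :
    ∃ c : Fin n → k, M.mulVec (cst c) = v :=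
  ⟨fun j => ct (w j), by
    have := decompose_mulVec hM (d := 0) hv h
    simp only [decompose_zero] at this
    exact this⟩

theorem cst_zero : cst (0 : Fin m → k) = 0 := by funext j; simp [cst]

theorem cst_sub (c d : Fin m → k) : cst (c - d) = cst c - cst d := by funext j; simp [cst]

end Parts

/-- Dependent choice with an invariant `Q`; chain maps are built with it one degree at a time. -/
theorem exists_seq {X : ℕ → Type*} (Q : ∀ n, X n → Prop) (P : ∀ n, X n → X (n + 1) → Prop)
    (x₀ : X 0) (h₀ : Q 0 x₀) (hs : ∀ n x, Q n x → ∃ y, P n x y ∧ Q (n + 1) y) :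
    ∃ f : ∀ n, X n, f 0 = x₀ ∧ (∀ n, Q n (f n)) ∧ ∀ n, P n (f n) (f (n + 1)) := by
  choose next hP hQ using hs
  let f : ∀ n, {x : X n // Q n x} := fun n =>
    Nat.rec (motive := fun n => {x : X n // Q n x}) ⟨x₀, h₀⟩
      (fun n x => ⟨next n x.1 x.2, hQ n x.1 x.2⟩) n
  exact ⟨fun n => (f n).1, rfl, fun n => (f n).2, fun n => hP n _ (f n).2⟩

theorem sub_neg_one_pow_succ_smul {A M : Type*} [CommRing A] [AddCommGroup M] [Module A M] (q : ℕ)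
    (u v : M) : u - (-1 : A) ^ (q + 1) • v = u + (-1 : A) ^ q • v := by
  rw [pow_succ, mul_neg_one, neg_smul, sub_neg_eq_add]

/-! ### The complex `P` and lifting in the total complex. -/

section Koszul

/-- The first coefficient of the differential of the resolution of `k` over `R'`. -/
noncomputable def cl (k : Type*) [Field k] (p : ℕ) : R k := if Even p then x k else -y k
/-- The second coefficient of the differential of the resolution of `k` over `R'`. -/
noncomputable def cr (k : Type*) [Field k] (p : ℕ) : R k := if Even p then y k else x k

theorem cl_mem (p : ℕ) : cl k p ∈ gr k 1 := by
  unfold cl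
  split_ifs
  exacts [x_mem, neg_mem y_mem]

theorem cr_mem (p : ℕ) : cr k p ∈ gr k 1 := by
  unfold cr
  split_ifs
  exacts [y_mem, x_mem]

/-- The differential `P_{p+1} → P_p` of the resolution of `k` over `R'`, where `P_p` has basis
`0, …, p`, tensored with a module. -/
noncomputable def dP (k : Type*) [Field k] {M : Type*} [AddCommGroup M] [Module (R k) M] (p : ℕ)
    (z : ℕ → M) (i : ℕ) : M :=
  cl k p • z i + cr k p • z (i + 1)

theorem cl_mul_cl (p : ℕ) : cl k p * cl k (p + 1) = 0 := by
  by_cases h : Even p <;> simp [cl, h, Nat.even_add_one] <;> grind [x_mul_y]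

theorem cr_mul_cr (p : ℕ) : cr k p * cr k (p + 1) = 0 := by
  by_cases h : Even p <;> simp [cr, h, Nat.even_add_one, x_mul_y, y_mul_x]

theorem cl_mul_cr (p : ℕ) : cl k p * cr k (p + 1) + cr k p * cl k (p + 1) = 0 := by
  by_cases h : Even p <;> simp [cl, cr, h, Nat.even_add_one] <;> grind [x_mul_x]

section

variable {M : Type*} [AddCommGroup M] [Module (R k) M]

/-- Only `xy = 0` and `x² = y²` are needed. These relations of `R'` hold in `R` too, which is how
the retract enters the argument. -/
theorem dP_dP (p : ℕ) (z : ℕ → M) (i : ℕ) : dP k p (dP k (p + 1) z) i = 0 := by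
  have h : dP k p (dP k (p + 1) z) i = (cl k p * cl k (p + 1)) • z i
      + (cl k p * cr k (p + 1) + cr k p * cl k (p + 1)) • z (i + 1)
      + (cr k p * cr k (p + 1)) • z (i + 2) := by
    simp only [dP]
    module
  have h0 : ∀ v : M, (0 : R k) • v = 0 := fun v => zero_smul (R k) v
  rw [h, cl_mul_cl, cl_mul_cr, cr_mul_cr, h0, h0, h0, add_zero, add_zero]

theorem dP_congr {p : ℕ} {z w : ℕ → M} {i : ℕ} (h0 : z i = w i) (h1 : z (i + 1) = w (i + 1)) :
    dP k p z i = dP k p w i := by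
  simp only [dP, h0, h1]

theorem map_dP {M' : Type*} [AddCommGroup M'] [Module (R k) M'] (f : M →ₗ[R k] M') (p : ℕ)
    (z : ℕ → M) (i : ℕ) : f (dP k p z i) = dP k p (fun i => f (z i)) i := by
  simp [dP]

end

theorem neg_y_mul (r : R k) : -y k * r = -(y k * r) := by ring

theorem coord_of_mem_span {r : R k} (hr : r ∈ Ideal.span {a k, b k}) :
    lx r = 0 ∧ ly r = 0 ∧ cS r = 0 := by
  obtain ⟨u, v, rfl⟩ := Ideal.mem_span_pair.1 hr
  simp [mul_comm u, mul_comm v]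

theorem lx_sub_mem {r : R k} (hr : r ∈ gr k 1) :
    r - (algebraMap k (R k) (lx r) * x k + algebraMap k (R k) (ly r) * y k) ∈
      Ideal.span {a k, b k} := by
  obtain ⟨u, v, w, z, rfl⟩ := exists_of_mem_one hr
  rw [Ideal.mem_span_pair]
  refine ⟨algebraMap k (R k) w, algebraMap k (R k) z, ?_⟩
  simp only [lx_add, ly_add, mul_comm _ (x k), mul_comm _ (y k), mul_comm _ (a k),
    mul_comm _ (b k), lx_x_mul, ly_x_mul, lx_y_mul, ly_y_mul, lx_a_mul, ly_a_mul, lx_b_mul,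
    ly_b_mul, ct_algebraMap, add_zero, zero_add]
  ring

/-- Exactness of `P` over `R' = R/U` on linear cycles. Each `z i` prescribes the constants at `i`
and `i + 1` through its coefficients of `x` and `y`; the coefficient of `x²` in the cycle condition
says that neighbouring prescriptions agree. -/
theorem exists_dP_sub_mem (p : ℕ) (z : ℕ → R k) (hz : ∀ i, z i ∈ gr k 1)
    (hc : ∀ p', p = p' + 1 → ∀ i ≤ p', dP k p' z i ∈ Ideal.span {a k, b k}) :
    ∃ c : ℕ → k, ∀ i ≤ p,
      z i - dP k p (fun i => algebraMap k (R k) (c i)) i ∈ Ideal.span {a k, b k} := by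
  by_cases hp : Even p
  · refine ⟨fun i => Nat.casesOn i (lx (z 0)) fun j => ly (z j), fun i hi => ?_⟩
    have h : (Nat.casesOn i (lx (z 0)) fun j => ly (z j) : k) = lx (z i) := by
      cases i with
      | zero => rfl
      | succ j =>
        obtain ⟨p', rfl⟩ : ∃ p', p = p' + 1 := ⟨p - 1, by omega⟩
        have hp' : ¬ Even p' := by simpa [Nat.even_add_one] using hp
        have := (coord_of_mem_span (hc p' rfl j (by omega))).2.2
        simp [dP, cl, cr, hp', neg_y_mul] at this
        exact neg_add_eq_zero.1 this
    convert lx_sub_mem (hz i) using 2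
    simp only [dP, cl, cr, hp, if_true, smul_eq_mul, h]
    ring
  · refine ⟨fun i => Nat.casesOn i (-ly (z 0)) fun j => lx (z j), fun i hi => ?_⟩
    have h : (Nat.casesOn i (-ly (z 0)) fun j => lx (z j) : k) = -ly (z i) := by
      cases i with
      | zero => rfl
      | succ j =>
        obtain ⟨p', rfl⟩ : ∃ p', p = p' + 1 := ⟨p - 1, by omega⟩
        have hp' : Even p' := by simpa [Nat.even_add_one] using hp
        have := (coord_of_mem_span (hc p' rfl j (by omega))).2.2
        simp [dP, cl, cr, hp'] at this
        exact eq_neg_of_add_eq_zero_left this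
    convert lx_sub_mem (hz i) using 2
    simp only [dP, cl, cr, hp, if_false, smul_eq_mul, h, map_neg]
    ring

theorem eq_zero_of_dP_mem {p : ℕ} {c : ℕ → k} {i : ℕ}
    (h : dP k p (fun i => algebraMap k (R k) (c i)) i ∈ Ideal.span {a k, b k}) :
    c i = 0 ∧ c (i + 1) = 0 := by
  obtain ⟨h1, h2, -⟩ := coord_of_mem_span h
  by_cases hp : Even p <;> simp [dP, cl, cr, hp, neg_y_mul, ct_algebraMap] at h1 h2
  exacts [⟨h1, h2⟩, ⟨h2, h1⟩]

variable {g : ℕ → ℕ} (N : ∀ q, Matrix (Fin (g q)) (Fin (g (q + 1))) (R k))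

/-- The cycles of the complex `⋯ → R^{g 1} → R^{g 0} → R' ^ {g 0}`. -/
noncomputable def cyc : ∀ q, Submodule (R k) (Fin (g q) → R k)
  | 0 => Submodule.pi Set.univ fun _ => Ideal.span {a k, b k}
  | q + 1 => LinearMap.ker (N q).mulVecLin

/-- The differential, with target in bidegree `(p, q)`, of the total complex of the tensor product
of the complex `N` with the resolution of `k` over `R'`. -/
noncomputable def dK (p q : ℕ) (z : ∀ q, ℕ → Fin (g q) → R k) (i : ℕ) : Fin (g q) → R k :=
  (N q).mulVec (z (q + 1) i) + (-1 : R k) ^ q • dP k p (z q) i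

/-- The first `m` steps of `N` are a minimal linear resolution of `R' ^ {g 0}`, as far as linear
cycles are concerned. -/
structure IsLinearStrand (m : ℕ) : Prop where
  lin : ∀ q i j, N q i j ∈ gr k 1
  mem_cyc : ∀ q v, (N q).mulVec v ∈ cyc N q
  exact : ∀ q < m, ∀ v ∈ cyc N q, IsLin v → ∃ c, (N q).mulVec (cst c) = v
  minimal : ∀ q < m, ∀ c, (N q).mulVec (cst c) = 0 → c = 0

variable {N} {m : ℕ}

theorem dK_sum {ι : Type*} (s : Finset ι) (r : ι → R k) (w : ι → ∀ q, ℕ → Fin (g q) → R k)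
    (p q i : ℕ) : dK N p q (fun q i => ∑ l ∈ s, r l • w l q i) i = ∑ l ∈ s, r l • dK N p q (w l) i := by
  simp only [dK, dP, Matrix.mulVec_sum, Matrix.mulVec_smul, smul_add, Finset.sum_add_distrib,
    Finset.smul_sum]
  congr 1
  congr 1 <;> exact Finset.sum_congr rfl fun l _ => by module

/-- Solve upwards in `q`. Exactness of `P` modulo `U` gives the component at `q = 0` and leaves a
remainder in `cyc N 0`; exactness of `N` lifts the remainder to the next component, and the cycle
condition puts the next remainder in `cyc N`. At `q = m` lifting stops, and only membership of the
remainder in `cyc N m` is kept. -/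
theorem exists_partial_lift (hN : IsLinearStrand N m) (hm : 0 < m) (n : ℕ)
    (z : ∀ q, ℕ → Fin (g q) → R k) (hz : ∀ q i, IsLin (z q i))
    (hc : ∀ p q, p + q + 1 = n → q < m → ∀ i ≤ p, dK N p q z i = 0) :
    ∃ c : ∀ q, ℕ → Fin (g q) → k,
      (∀ p q, p + q = n → q < m → ∀ i ≤ p, dK N p q (fun q i => cst (c q i)) i = z q i) ∧
      ∀ p q, p + q = n → q ≤ m → ∀ i ≤ p,
        z q i - (-1 : R k) ^ q • dP k p (fun i => cst (c q i)) i ∈ cyc N q := by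
  have h0 : ∀ j : Fin (g 0), ∃ c : ℕ → k, ∀ i ≤ n,
      z 0 i j - dP k n (fun i => algebraMap k (R k) (c i)) i ∈ Ideal.span {a k, b k} := by
    intro j
    refine exists_dP_sub_mem n (fun i => z 0 i j) (fun i => hz 0 i j) ?_
    rintro p rfl i hi
    have h := congrFun (hc p 0 rfl hm i hi) j
    have hmem : (N 0).mulVec (z 1 i) j ∈ Ideal.span {a k, b k} :=
      (Submodule.mem_pi.1 (hN.mem_cyc 0 (z 1 i))) j (Set.mem_univ j)
    have e : dP k p (fun i => z 0 i j) i = -(N 0).mulVec (z 1 i) j := by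
      simp only [dK, pow_zero, one_smul, Pi.add_apply, Pi.zero_apply] at h
      exact (neg_eq_of_add_eq_zero_right h).symm
    rw [e]
    exact neg_mem hmem
  choose c0 hc0 using h0
  refine (exists_seq (X := fun q => ℕ → Fin (g q) → k)
    (fun q c => ∀ p, p + q = n → q ≤ m → ∀ i ≤ p,
      z q i - (-1 : R k) ^ q • dP k p (fun i => cst (c i)) i ∈ cyc N q)
    (fun q c c' => ∀ p, p + q = n → q < m → ∀ i ≤ p,
      (N q).mulVec (cst (c' i)) = z q i - (-1 : R k) ^ q • dP k p (fun i => cst (c i)) i)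
    (fun i j => c0 j i) ?_ ?_).elim fun c ⟨_, hQ, hP⟩ => ?_
  rotate_left 2
  · refine ⟨c, fun p q hpq hq i hi => ?_, fun p q hpq hq i hi => hQ q p hpq hq i hi⟩
    rw [dK, hP q p hpq hq i hi, sub_add_cancel]
  · rintro p rfl - i hi
    refine Submodule.mem_pi.2 fun j _ => ?_
    rw [pow_zero, one_smul]
    exact hc0 j i hi
  · intro q c hQ
    by_cases hq : q < m ∧ q ≤ n
    · have hex : ∀ i, ∃ d : Fin (g (q + 1)) → k, i ≤ n - q → (N q).mulVec (cst d) =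
          z q i - (-1 : R k) ^ q • dP k (n - q) (fun i => cst (c i)) i := by
        intro i
        by_cases hi : i ≤ n - q
        · have hl : IsLin (dP k (n - q) (fun i => cst (c i)) i) := fun j =>
            add_mem (isLin_smul_cst (cl_mem _) _ j) (isLin_smul_cst (cr_mem _) _ j)
          have hl' : IsLin (z q i - (-1 : R k) ^ q • dP k (n - q) (fun i => cst (c i)) i) := by
            refine fun j => sub_mem (hz q i j) ?_
            rcases neg_one_pow_eq_or (R k) q with e | e <;> rw [e]
            · rw [one_smul]
              exact hl j
            · rw [neg_one_smul]
              exact neg_mem (hl j)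
          exact (hN.exact q hq.1 _ (hQ (n - q) (by omega) hq.1.le i hi) hl').imp fun d hd _ => hd
        · exact ⟨0, fun h => absurd h hi⟩
      choose c' hc' using hex
      refine ⟨c', ?_, ?_⟩
      · rintro p hp - i hi
        obtain rfl : p = n - q := by omega
        exact hc' i hi
      · rintro p hp hq' i hi
        have hpq : n - q = p + 1 := by omega
        rw [hpq] at hc'
        have hcyc := hc p q (by omega) hq.1 i hi
        change _ ∈ LinearMap.ker (N q).mulVecLin
        -- `N q` sends the new component to the previous remainder, whose correction term dies under
        -- `dP ∘ dP`; what is left is the cycle condition at `(p, q)`.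
        rw [LinearMap.mem_ker, map_sub, map_smul, map_dP]
        simp only [Matrix.mulVecLin_apply]
        rw [dP_congr (w := fun i => z q i - (-1 : R k) ^ q • dP k (p + 1) (fun i => cst (c i)) i)
          (hc' i (by omega)) (hc' (i + 1) (by omega))]
        have e : dP k p (fun i => z q i - (-1 : R k) ^ q • dP k (p + 1) (fun i => cst (c i)) i) i =
            dP k p (z q) i - (-1 : R k) ^ q • dP k p (dP k (p + 1) fun i => cst (c i)) i := by
          simp only [dP]
          module
        rw [e, dP_dP, smul_zero, sub_zero]
        exact (sub_neg_one_pow_succ_smul _ _ _).trans hcyc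
    -- Outside this range nothing is required of the next component.
    · refine ⟨0, fun p hp hq' => absurd ⟨hq', by omega⟩ hq, fun p hp hq' => ?_⟩
      exact absurd ⟨by omega, by omega⟩ hq

end Koszul

end BadAlgebra

namespace BadAlgebra

variable {k : Type*} [Field k]

theorem sum_smul_sum_smul {A M : Type*} [CommRing A] [AddCommGroup M] [Module A M] {m n : ℕ}
    (B : Matrix (Fin m) (Fin n) A) (t : Fin n → A) (v : Fin m → M) :
    ∑ j, t j • ∑ l, B l j • v l = ∑ l, B.mulVec t l • v l := by
  simp only [Matrix.mulVec, dotProduct, Finset.smul_sum, Finset.sum_smul]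
  rw [Finset.sum_comm]
  exact Finset.sum_congr rfl fun l _ => Finset.sum_congr rfl fun j _ => by
    rw [smul_smul, mul_comm]

theorem sum_smul_sum_smul_eq_zero {A M : Type*} [CommRing A] [AddCommGroup M] [Module A M]
    {m n : ℕ} {B : Matrix (Fin m) (Fin n) A} {t : Fin n → A} (h : B.mulVec t = 0)
    (v : Fin m → M) : ∑ j, t j • ∑ l, B l j • v l = 0 := by
  rw [sum_smul_sum_smul, h]
  exact Finset.sum_eq_zero fun l _ => zero_smul _ _

theorem mulVec_col_eq_zero {A : Type*} [CommRing A] {l m n : ℕ}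
    {B : Matrix (Fin l) (Fin m) A} {C : Matrix (Fin m) (Fin n) A}
    (h : ∀ v, B.mulVec (C.mulVec v) = 0) (j : Fin n) : B.mulVec (fun i => C i j) = 0 := by
  have hj := h (Pi.single j 1)
  rwa [Matrix.mulVec_single_one] at hj

theorem sum_algebraMap_smul_cst {ι : Type*} [Fintype ι] {m : ℕ} (c : ι → k) (v : ι → Fin m → k) :
    ∑ l, algebraMap k (R k) (c l) • cst (v l) = cst (∑ l, c l • v l) := by
  funext j
  simp only [cst, Finset.sum_apply, Pi.smul_apply, smul_eq_mul, map_sum, map_mul]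

theorem mulVec_sum_smul {A : Type*} [CommRing A] {ι : Type*} [Fintype ι] {m n : ℕ}
    (B : Matrix (Fin m) (Fin n) A) (t : ι → A) (v : ι → Fin n → A) :
    B.mulVec (∑ l, t l • v l) = ∑ l, t l • B.mulVec (v l) := by
  rw [Matrix.mulVec_sum]
  exact Finset.sum_congr rfl fun l _ => Matrix.mulVec_smul _ _ _

/-! ### Comparison maps and the obstruction to being Koszul. -/

section Koszul

variable {g : ℕ → ℕ} {N : ∀ q, Matrix (Fin (g q)) (Fin (g (q + 1))) (R k)} {m : ℕ}

/-- At `q = 0` the equation modulo `U` involves `P` alone, whose differential kills no nonzero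
constants. Once component `q` vanishes, the equation for component `q + 1` involves `N q` alone.
This is the uniqueness behind the comparison of chain maps. -/
theorem IsLinearStrand.eq_zero_of_dK_eq_zero (hN : IsLinearStrand N m) {n : ℕ} (hn : n < m)
    {c : ∀ q, ℕ → Fin (g q) → k}
    (hc : ∀ p q, p + q = n → ∀ i ≤ p, dK N p q (fun q i => cst (c q i)) i = 0) :
    ∀ q p, p + q = n + 1 → ∀ i ≤ p, c q i = 0 := by
  intro q
  induction q with
  | zero =>
    rintro p rfl i hi
    have key : ∀ i ≤ n, ∀ j, c 0 i j = 0 ∧ c 0 (i + 1) j = 0 := by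
      intro i hi j
      have h := congrFun (hc n 0 rfl i hi) j
      have hmem : (N 0).mulVec (cst (c 1 i)) j ∈ Ideal.span {a k, b k} :=
        (Submodule.mem_pi.1 (hN.mem_cyc 0 (cst (c 1 i)))) j (Set.mem_univ j)
      have e : dP k n (fun i => algebraMap k (R k) (c 0 i j)) i =
          -(N 0).mulVec (cst (c 1 i)) j := by
        simp only [dK, pow_zero, one_smul, Pi.add_apply, Pi.zero_apply] at h
        exact (neg_eq_of_add_eq_zero_right h).symm
      exact eq_zero_of_dP_mem (e ▸ neg_mem hmem)
    funext j
    cases i with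
    | zero => exact (key 0 (by omega) j).1
    | succ i => exact (key i (by omega) j).2
  | succ q ih =>
    intro p hp i hi
    refine hN.minimal q (by omega) _ ?_
    have h := hc p q (by omega) i hi
    have e : dP k p (fun i => cst (c q i)) i = 0 := by
      rw [dP, ih (p + 1) (by omega) i (by omega), ih (p + 1) (by omega) (i + 1) (by omega),
        cst_zero, smul_zero, smul_zero, add_zero]
    rw [dK, e, smul_zero, add_zero] at h
    exact h

variable {β : ℕ → ℕ} {D : ∀ i, Matrix (Fin (β i)) (Fin (β (i + 1))) (R k)}

/-- A chain map from `D` to the total complex, with constant entries, obtained by lifting the images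
of the columns of `D` degree by degree. They are cycles because consecutive differentials of `D`
compose to zero. -/
theorem IsLinearStrand.exists_chainMap (hN : IsLinearStrand N m) (hm : 0 < m)
    (hD : ∀ i p q, D i p q ∈ gr k 1) (hDD : ∀ i v, (D i).mulVec ((D (i + 1)).mulVec v) = 0)
    (e : Fin (β 0) → k) :
    ∃ γ : ∀ n, Fin (β n) → ∀ q, ℕ → Fin (g q) → k,
      (∀ l q i s, γ 0 l q i s = e l) ∧
      (∀ n ≤ m, ∀ j p q, p + q + 1 = n → ∀ i ≤ p,
        dK N p q (fun q i => ∑ l, D n l j • cst (γ n l q i)) i = 0) ∧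
      ∀ n < m, ∀ j p q, p + q = n → ∀ i ≤ p,
        dK N p q (fun q i => cst (γ (n + 1) j q i)) i = ∑ l, D n l j • cst (γ n l q i) := by
  refine (exists_seq (X := fun n => Fin (β n) → ∀ q, ℕ → Fin (g q) → k)
    (fun n γ => n ≤ m → ∀ j p q, p + q + 1 = n → ∀ i ≤ p,
      dK N p q (fun q i => ∑ l, D n l j • cst (γ l q i)) i = 0)
    (fun n γ γ' => n < m → ∀ j p q, p + q = n → ∀ i ≤ p,
      dK N p q (fun q i => cst (γ' j q i)) i = ∑ l, D n l j • cst (γ l q i))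
    (fun l _ _ _ => e l) (fun _ _ _ _ h => by omega) ?_).elim fun γ ⟨h0, hQ, hP⟩ =>
      ⟨γ, fun l q i s => by rw [h0], hQ, hP⟩
  intro n γ hγ
  by_cases hn : n < m
  · have hlift := fun j => exists_partial_lift hN hm n
      (fun q i => ∑ l, D n l j • cst (γ l q i))
      (fun q i => IsLin.sum fun l => isLin_smul_cst (hD n l j) _)
      (fun p q hpq _ i hi => hγ hn.le j p q hpq i hi)
    choose γ' h1 _ using hlift
    have hP : ∀ j p q, p + q = n → ∀ i ≤ p,
        dK N p q (fun q i => cst (γ' j q i)) i = ∑ l, D n l j • cst (γ l q i) :=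
      fun j p q hpq i hi => h1 j p q hpq (by omega) i hi
    refine ⟨γ', fun _ => hP, fun _ j p q hpq i hi => ?_⟩
    rw [dK_sum, Finset.sum_congr rfl fun l _ => by rw [hP l p q (by omega) i hi]]
    exact sum_smul_sum_smul_eq_zero (mulVec_col_eq_zero (hDD n) j) _
  · exact ⟨0, fun h => absurd h hn, fun h => absurd h (by omega)⟩

/-- A chain map from `N` to `D`, by exactness of `D`; the entries can be taken constant since both
differentials are linear. -/
theorem IsLinearStrand.exists_comparison (hN : IsLinearStrand N m)
    (hD : ∀ i p q, D i p q ∈ gr k 1) {M : Type*} [AddCommGroup M] [Module (R k) M]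
    {ε : (Fin (β 0) → R k) →ₗ[R k] M} (h0 : LinearMap.range (D 0).mulVecLin = LinearMap.ker ε)
    (h1 : ∀ i, LinearMap.range (D (i + 1)).mulVecLin = LinearMap.ker (D i).mulVecLin)
    (c : Fin (β 0) → k) (hc : ∀ r ∈ gr k 1, r • ε (cst c) = 0) :
    ∃ α : ∀ n, Fin (g n) → Fin (β n) → k, (∀ j, α 0 j = c) ∧
      ∀ n j, (D n).mulVec (cst (α (n + 1) j)) = ∑ l, N n l j • cst (α n l) := by
  let Z : ∀ n, Submodule (R k) (Fin (β n) → R k) := fun n =>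
    Nat.casesOn n (LinearMap.ker ε) fun n => LinearMap.ker (D n).mulVecLin
  have hZ : ∀ n, LinearMap.range (D n).mulVecLin = Z n := by
    rintro (_ | n)
    exacts [h0, h1 n]
  refine (exists_seq (X := fun n => Fin (g n) → Fin (β n) → k)
    (fun n α => ∀ j, ∑ l, N n l j • cst (α l) ∈ Z n)
    (fun n α α' => ∀ j, (D n).mulVec (cst (α' j)) = ∑ l, N n l j • cst (α l))
    (fun _ => c) ?_ ?_).elim fun α ⟨h0, _, hP⟩ => ⟨α, fun j => by rw [h0], hP⟩
  · intro j
    change _ ∈ LinearMap.ker ε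
    rw [LinearMap.mem_ker, map_sum]
    exact Finset.sum_eq_zero fun l _ => by rw [map_smul, hc _ (hN.lin 0 l j)]
  · intro n α hα
    have hex : ∀ j, ∃ d, (D n).mulVec (cst d) = ∑ l, N n l j • cst (α l) := by
      intro j
      obtain ⟨w, hw⟩ := (hZ n).symm ▸ hα j
      exact exists_cst_of_mulVec (hD n) (IsLin.sum fun l => isLin_smul_cst (hN.lin n l j) _) hw
    choose α' hα' using hex
    refine ⟨α', hα', fun j => ?_⟩
    change _ ∈ LinearMap.ker (D n).mulVecLin
    rw [LinearMap.mem_ker, Matrix.mulVecLin_apply, mulVec_sum_smul,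
      Finset.sum_congr rfl fun l _ => by rw [hα' l]]
    exact sum_smul_sum_smul_eq_zero
      (mulVec_col_eq_zero (fun v => hN.mem_cyc (n + 1) v) j) _

/-- The inclusion of `N n` in the part of total degree `n` of the tensor product. -/
def inc (n : ℕ) (j : Fin (g n)) (q : ℕ) (s : Fin (g q)) : k := if q = n ∧ s.1 = j.1 then 1 else 0

theorem inc_self (n : ℕ) (j : Fin (g n)) : inc (k := k) n j n = Pi.single j 1 := by
  funext s
  simp [inc, Pi.single_apply, Fin.ext_iff]

theorem inc_of_ne {n q : ℕ} (h : q ≠ n) (j : Fin (g n)) : inc (k := k) n j q = 0 := by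
  funext s
  simp [inc, h]

theorem cst_single {n : ℕ} (j : Fin n) : cst (Pi.single j (1 : k)) = Pi.single j 1 := by
  funext s
  by_cases h : s = j
  · subst h
    simp [cst]
  · simp [cst, h]

theorem sum_smul_cst_inc_self {n : ℕ} (v : Fin (g n) → R k) :
    ∑ j, v j • cst (inc n j n) = v := by
  simp only [inc_self, cst_single]
  funext s
  rw [Finset.sum_apply, Finset.sum_eq_single s]
  · simp
  · intro j _ hj
    simp [hj.symm]
  · simp

theorem sum_smul_cst_inc_of_ne {n q : ℕ} (h : q ≠ n) (v : Fin (g n) → R k) :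
    ∑ j, v j • cst (inc n j q) = (0 : Fin (g q) → R k) :=
  Finset.sum_eq_zero fun j _ => by rw [inc_of_ne h, cst_zero, smul_zero]

/-- The composite and the inclusion are chain maps with constant entries that agree in degree zero,
so their difference vanishes inductively by `IsLinearStrand.eq_zero_of_dK_eq_zero`. -/
theorem IsLinearStrand.comparison_comp_chainMap (hN : IsLinearStrand N m) (hg : g 0 = 1)
    {γ : ∀ n, Fin (β n) → ∀ q, ℕ → Fin (g q) → k} {α : ∀ n, Fin (g n) → Fin (β n) → k}
    (h0 : ∀ j q i s, ∑ l, α 0 j l * γ 0 l q i s = 1)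
    (hγ : ∀ n < m, ∀ j p q, p + q = n → ∀ i ≤ p,
      dK N p q (fun q i => cst (γ (n + 1) j q i)) i = ∑ l, D n l j • cst (γ n l q i))
    (hα : ∀ n j, (D n).mulVec (cst (α (n + 1) j)) = ∑ l, N n l j • cst (α n l)) {n : ℕ}
    (hn : n ≤ m) (j : Fin (g n)) {p q : ℕ} (hpq : p + q = n) {i : ℕ} (hi : i ≤ p) :
    ∑ l, α n j l • γ n l q i = inc n j q := by
  induction n generalizing p q i with
  | zero =>
    obtain ⟨rfl, rfl⟩ : p = 0 ∧ q = 0 := by omega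
    funext s
    rw [Finset.sum_apply]
    simp only [Pi.smul_apply, smul_eq_mul, h0]
    rw [inc, if_pos ⟨rfl, by omega⟩]
  | succ n ih =>
    refine sub_eq_zero.1 (hN.eq_zero_of_dK_eq_zero hn
      (c := fun q i => ∑ l, α (n + 1) j l • γ (n + 1) l q i - inc (n + 1) j q) ?_ q p hpq i hi)
    intro p q hpq i hi
    have e1 : dK N p q (fun q i => cst (∑ l, α (n + 1) j l • γ (n + 1) l q i)) i =
        ∑ t, N n t j • cst (inc n t q) := by
      simp only [← sum_algebraMap_smul_cst]
      rw [dK_sum, Finset.sum_congr rfl fun l _ => by rw [hγ n hn l p q hpq i hi]]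
      refine (sum_smul_sum_smul (D n) (cst (α (n + 1) j)) _).trans ?_
      rw [hα]
      simp only [← ih (Nat.le_of_lt hn) _ hpq hi, ← sum_algebraMap_smul_cst]
      simp only [Finset.sum_apply, Pi.smul_apply, smul_eq_mul, Finset.sum_smul, Finset.smul_sum,
        smul_smul]
      rw [Finset.sum_comm]
      rfl
    have e2 : dK N p q (fun q _ => cst (inc (n + 1) j q)) i = ∑ t, N n t j • cst (inc n t q) := by
      simp only [dK, dP]
      rw [inc_of_ne (q := q) (by omega), cst_zero, smul_zero, smul_zero, add_zero, smul_zero,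
        add_zero]
      by_cases h : q = n
      · subst h
        rw [sum_smul_cst_inc_self, inc_self, cst_single, Matrix.mulVec_single_one]
        rfl
      · rw [inc_of_ne (by omega), cst_zero, Matrix.mulVec_zero, sum_smul_cst_inc_of_ne h]
    have e3 : dK N p q (fun q i => cst (∑ l, α (n + 1) j l • γ (n + 1) l q i - inc (n + 1) j q)) i =
        dK N p q (fun q i => cst (∑ l, α (n + 1) j l • γ (n + 1) l q i)) i -
          dK N p q (fun q _ => cst (inc (n + 1) j q)) i := by
      simp only [dK, dP, cst_sub, Matrix.mulVec_sub]
      module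
    rw [e3, e1, e2, sub_self]

/-- Lift each cycle `z j` to constants `c j`. At `q = L` this splits `z j` into an element of `cyc N
L`, harmless after multiplication by `t j`, and a `dP`-term. Since `∑ t j • z j` vanishes for `q <
L`, the combination `∑ t j • c j` satisfies the cycle condition and lifts once more, to `e`. Its
remainder lies in `cyc N L`, and applying `dP` gives exactly the sum of the `dP`-terms because `dP ∘
dP = 0`. -/
theorem IsLinearStrand.sum_smul_mem {L : ℕ} (hN : IsLinearStrand N L) (hL : 0 < L) {ι : Type*}
    [Fintype ι] {t : ι → R k} (ht : ∀ j, t j ∈ gr k 1) {z : ι → ∀ q, ℕ → Fin (g q) → R k}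
    (hz : ∀ j q i, IsLin (z j q i))
    (hc : ∀ j p q, p + q + 1 = L → ∀ i ≤ p, dK N p q (z j) i = 0)
    (hs : ∀ p q, p + q = L → q < L → ∀ i ≤ p, ∑ j, t j • z j q i = 0) :
    ∑ j, t j • z j L 0 ∈ irr k • cyc N L := by
  have hlift := fun j => exists_partial_lift hN hL L (z j) (hz j)
    fun p q hpq _ i hi => hc j p q hpq i hi
  choose c hc1 hc2 using hlift
  obtain ⟨e, -, he⟩ := exists_partial_lift hN hL (L + 1)
    (fun q i => ∑ j, t j • cst (c j q i)) (fun q i => IsLin.sum fun j => isLin_smul_cst (ht j) _)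
    (fun p q hpq hq i hi => by
      rw [dK_sum, Finset.sum_congr rfl fun j _ => by rw [hc1 j p q (by omega) hq i hi]]
      exact hs p q (by omega) hq i hi)
  have h1 : ∑ j, t j • (z j L 0 - (-1 : R k) ^ L • dP k 0 (fun i => cst (c j L i)) 0) ∈
      irr k • cyc N L :=
    Submodule.sum_mem _ fun j _ =>
      Submodule.smul_mem_smul (mem_irr_of_mem_one (ht j)) (hc2 j 0 L (by omega) le_rfl 0 le_rfl)
  have h2 : dP k 0 (fun i => ∑ j, t j • cst (c j L i) -
      (-1 : R k) ^ L • dP k 1 (fun i => cst (e L i)) i) 0 ∈ irr k • cyc N L :=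
    add_mem
      (Submodule.smul_mem_smul (mem_irr_of_mem_one (cl_mem 0))
        (he 1 L (by omega) le_rfl 0 (by omega)))
      (Submodule.smul_mem_smul (mem_irr_of_mem_one (cr_mem 0))
        (he 1 L (by omega) le_rfl 1 le_rfl))
  have e2 : dP k 0 (fun i => ∑ j, t j • cst (c j L i) -
      (-1 : R k) ^ L • dP k 1 (fun i => cst (e L i)) i) 0 =
      ∑ j, t j • dP k 0 (fun i => cst (c j L i)) 0 := by
    have h : dP k 0 (fun i => ∑ j, t j • cst (c j L i) -
        (-1 : R k) ^ L • dP k 1 (fun i => cst (e L i)) i) 0 =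
        dP k 0 (fun i => ∑ j, t j • cst (c j L i)) 0 -
          (-1 : R k) ^ L • dP k 0 (dP k (0 + 1) (fun i => cst (e L i))) 0 := by
      simp only [dP]
      module
    rw [h, dP_dP, smul_zero, sub_zero]
    simp only [dP, Finset.smul_sum, smul_add, Finset.sum_add_distrib]
    congr 1 <;> exact Finset.sum_congr rfl fun j _ => smul_comm _ _ _
  have e3 : ∑ j, t j • z j L 0 =
      ∑ j, t j • (z j L 0 - (-1 : R k) ^ L • dP k 0 (fun i => cst (c j L i)) 0) +
        (-1 : R k) ^ L • ∑ j, t j • dP k 0 (fun i => cst (c j L i)) 0 := by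
    rw [Finset.smul_sum, ← Finset.sum_add_distrib]
    exact Finset.sum_congr rfl fun j _ => by module
  rw [e3]
  exact add_mem h1 (Submodule.smul_mem _ _ (e2 ▸ h2))

/-- A quadratic minimal syzygy at the end of the linear strand of a resolution of `R'` prevents `R`
from being Koszul. -/
theorem IsLinearStrand.not_isKoszulAlgebra {n : ℕ} (hN : IsLinearStrand N (n + 1)) (hg : g 0 = 1)
    (hs : HasMinimalQuadraticSyzygy (gr k) (N n)) : ¬ IsKoszulAlgebra (gr k) := by
  rintro ⟨β, ε, D, hε, hD, hsurj, h0, h1⟩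
  have hmk : ∀ r : R k, Ideal.Quotient.mk (irr k) r =
      Ideal.Quotient.mk (irr k) (algebraMap k (R k) (ct r)) := fun r =>
    Ideal.Quotient.eq.2 (span_le_irr (sub_ct_mem r))
  have hmk1 : ∀ c : k, Ideal.Quotient.mk (irr k) (algebraMap k (R k) c) = 1 → c = 1 := by
    intro c hc
    have h : algebraMap k (R k) c - 1 ∈ irr k := Ideal.Quotient.eq.1 hc
    rw [mem_irr_iff, ← map_one (algebraMap k (R k)), ← map_sub, ct_algebraMap] at h
    exact sub_eq_zero.1 h
  -- The rank `β 0` is arbitrary: the scalars `e` record the augmentation, and `c` below is a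
  -- constant vector of augmentation one.
  have hex : ∀ l, ∃ e : k, ε (Pi.single l 1) = Ideal.Quotient.mk (irr k) (algebraMap k (R k) e) := by
    intro l
    obtain ⟨r, hr⟩ := Ideal.Quotient.mk_surjective (ε (Pi.single l 1))
    exact ⟨ct r, by rw [← hr, hmk]⟩
  choose e he using hex
  have hεv : ∀ v, ε v = Ideal.Quotient.mk (irr k) (∑ l, v l * algebraMap k (R k) (e l)) := by
    intro v
    rw [LinearMap.pi_apply_eq_sum_univ, map_sum]
    refine Finset.sum_congr rfl fun l _ => ?_
    have : (fun j => if l = j then (1 : R k) else 0) = Pi.single l 1 := by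
      funext j
      simp [Pi.single_apply, eq_comm]
    rw [this, he]
    rfl
  obtain ⟨w, hw⟩ := hsurj 1
  set c : Fin (β 0) → k := fun l => ct (w l) with hcdef
  have hc1 : ε (cst c) = 1 := by
    rw [← hw, hεv, hεv, map_sum, map_sum]
    refine Finset.sum_congr rfl fun l _ => ?_
    rw [map_mul, map_mul, hmk (w l)]
    rfl
  have hce : ∑ l, c l * e l = 1 := by
    apply hmk1
    rw [← hc1, hεv, map_sum]
    simp only [map_mul]
    rfl
  have hDD : ∀ i v, (D i).mulVec ((D (i + 1)).mulVec v) = 0 := fun i v => by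
    have : (D (i + 1)).mulVecLin v ∈ LinearMap.ker (D i).mulVecLin := h1 i ▸ ⟨v, rfl⟩
    exact this
  obtain ⟨γ, hγ0, hγc, hγ⟩ := hN.exists_chainMap n.succ_pos hD hDD e
  obtain ⟨α, hα0, hα⟩ := hN.exists_comparison hD h0 h1 c fun r hr => by
    rw [hc1]
    have : r • (1 : R k ⧸ irr k) = Ideal.Quotient.mk (irr k) r := by
      exact congrArg (Ideal.Quotient.mk (irr k)) (mul_one r)
    rw [this]
    exact Ideal.Quotient.eq_zero_iff_mem.2 (mem_irr_of_mem_one hr)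
  have hκ := fun j p q hpq i hi => hN.comparison_comp_chainMap hg
    (fun j q i s => by simp only [hα0, hγ0, hce]) hγ hα le_rfl j (p := p) (q := q) hpq (i := i) hi
  obtain ⟨s, hsker, hs2, hsmin⟩ := hs
  have hker : ∑ j, s j • cst (α (n + 1) j) ∈ LinearMap.ker (D n).mulVecLin := by
    rw [LinearMap.mem_ker, Matrix.mulVecLin_apply, mulVec_sum_smul,
      Finset.sum_congr rfl fun l _ => by rw [hα n l]]
    exact sum_smul_sum_smul_eq_zero hsker _
  obtain ⟨w', hw'⟩ := (h1 n).symm ▸ hker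
  -- The image of `s` is quadratic and `D` is linear, so the linear part of the preimage suffices.
  have ht := decompose_mulVec (hD (n + 1)) (d := 1) (fun l => by
    rw [Finset.sum_apply]
    exact Submodule.sum_mem _ fun j _ =>
      SetLike.mul_mem_graded (A := gr k) (i := 2) (j := 0) (hs2 j) (algebraMap_mem _)) hw'
  set t : Fin (β (n + 1 + 1)) → R k := fun j => DirectSum.decompose (gr k) (w' j) 1 with htdef
  -- As `γ ∘ α` is the inclusion, the equation carried to the total complex returns `s`, placed at
  -- `q = n + 1` alone.
  have hsum : ∀ p q, p + q = n + 1 → ∀ i ≤ p,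
      ∑ j, t j • ∑ l, D (n + 1) l j • cst (γ (n + 1) l q i) = ∑ j, s j • cst (inc (n + 1) j q) := by
    intro p q hpq i hi
    rw [sum_smul_sum_smul (D (n + 1)) t, ht]
    simp only [← hκ _ p q hpq i hi, ← sum_algebraMap_smul_cst, Finset.sum_apply, Pi.smul_apply,
      smul_eq_mul, Finset.sum_smul, Finset.smul_sum, smul_smul]
    rw [Finset.sum_comm]
    rfl
  refine hsmin ?_
  have := hN.sum_smul_mem n.succ_pos (t := t) (fun j => SetLike.coe_mem _)
    (z := fun j q i => ∑ l, D (n + 1) l j • cst (γ (n + 1) l q i))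
    (fun j q i => IsLin.sum fun l => isLin_smul_cst (hD _ l j) _)
    (fun j p q hpq i hi => hγc (n + 1) le_rfl j p q hpq i hi)
    (fun p q hpq hq i hi => by rw [hsum p q hpq i hi, sum_smul_cst_inc_of_ne (by omega)])
  rw [hsum 0 (n + 1) (by omega) 0 le_rfl, sum_smul_cst_inc_self] at this
  exact this

end Koszul

end BadAlgebra

/-! ### The strand formed by the given matrices, and the conclusion. -/

namespace BadAlgebra

variable {k : Type*} [Field k]

/-- The ranks in the linear strand of the resolution of `R'`. -/
def rk : ℕ → ℕ
  | 0 => 1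
  | 1 => 2
  | 2 => 3
  | 3 => 6
  | 4 => 11
  | 5 => 20
  | _ => 0

/-- The linear strand of the resolution of `R'`. -/
noncomputable def strand (k : Type*) [Field k] : ∀ q, Matrix (Fin (rk q)) (Fin (rk (q + 1))) (R k)
  | 0 => !![a k, b k]
  | 1 => d1 k
  | 2 => d2 k
  | 3 => d3 k
  | 4 => d4 k
  | _ + 5 => 0

theorem row_mulVec (v : Fin 2 → R k) (i : Fin 1) : (!![a k, b k]).mulVec v i = aug k v := by
  fin_cases i
  simp [aug_apply, Matrix.mulVec, dotProduct, Fin.sum_univ_two]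

theorem row_mulVec_eq_zero_iff (v : Fin 2 → R k) : (!![a k, b k]).mulVec v = 0 ↔ aug k v = 0 :=
  ⟨fun h => (row_mulVec v 0).symm.trans (congrFun h 0),
    fun h => funext fun i => (row_mulVec v i).trans h⟩

theorem cst_eq_zero_of_ct {m : ℕ} {c : Fin m → k} (h : ∀ j, ct (cst c j) = 0) : c = 0 :=
  funext fun j => (ct_algebraMap (c j)).symm.trans (h j)

theorem lin_strand (q : ℕ) (i : Fin (rk q)) (j : Fin (rk (q + 1))) : strand k q i j ∈ gr k 1 := by
  obtain _ | _ | _ | _ | _ | q := q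
  · fin_cases i
    fin_cases j
    exacts [a_mem, b_mem]
  · exact cover_d1.linear i j
  · exact cover_d2.linear i j
  · exact cover_d3.linear i j
  · exact mat4_mem (gr k 1).toAddSubgroup x_mem y_mem a_mem b_mem i j
  · exact zero_mem _

/-- Length 4 ends with `∂₃` and works over every field; length 5 also needs exactness of `∂₄`, hence
`2 ≠ 0`. The syzygy contradicting the Koszul property belongs to the last matrix in each case. -/
theorem isLinearStrand_strand {m : ℕ} (hm : m ≤ 5) (h2 : m = 5 → (2 : k) ≠ 0) :
    IsLinearStrand (strand k) m where
  lin := lin_strand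
  mem_cyc := by
    rintro (_ | _ | _ | _ | _ | q) v
    · refine Submodule.mem_pi.2 fun i _ => ?_
      exact Set.mem_of_eq_of_mem (row_mulVec v i) ((range_aug (k := k)).le ⟨v, rfl⟩)
    · refine (row_mulVec_eq_zero_iff _).2 ?_
      exact (range_d1 (k := k)).le ⟨v, rfl⟩
    · exact (range_d2 (k := k)).le ⟨v, rfl⟩
    · exact (range_d3 (k := k)).le ⟨v, rfl⟩
    · exact mat3_mul_mat4 b_mul_x x_mul_y a_mul_x x_mul_x v
    · change (strand k _).mulVec ((0 : Matrix _ _ (R k)).mulVec v) = 0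
      rw [Matrix.zero_mulVec, Matrix.mulVec_zero]
  exact := by
    rintro (_ | _ | _ | _ | _ | q) hq v hv hl
    · obtain ⟨w, hw⟩ := (range_aug (k := k)).ge (Submodule.mem_pi.1 hv (0 : Fin 1) trivial)
      refine exists_cst_of_mulVec (lin_strand 0) hl (w := w) (funext fun i => ?_)
      exact ((row_mulVec w i).trans hw).trans (congrArg v (Subsingleton.elim (0 : Fin 1) i))
    · obtain ⟨w, hw⟩ := (range_d1 (k := k)).ge ((row_mulVec_eq_zero_iff v).1 hv)
      exact exists_cst_of_mulVec (lin_strand 1) hl hw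
    · obtain ⟨w, hw⟩ := (range_d2 (k := k)).ge hv
      exact exists_cst_of_mulVec (lin_strand 2) hl hw
    · obtain ⟨w, hw⟩ := (range_d3 (k := k)).ge hv
      exact exists_cst_of_mulVec (lin_strand 3) hl hw
    · obtain ⟨w, hw⟩ := (range_d4 (h2 (by omega))).ge hv
      exact exists_cst_of_mulVec (lin_strand 4) hl hw
    · omega
  minimal := by
    rintro (_ | _ | _ | _ | _ | q) hq c hc
    · exact cst_eq_zero_of_ct (ct_eq_zero_of_aug ((row_mulVec_eq_zero_iff _).1 hc))
    · exact cst_eq_zero_of_ct (ct_eq_zero_of_d1 hc)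
    · exact cst_eq_zero_of_ct (ct_eq_zero_of_d2 hc)
    · exact cst_eq_zero_of_ct (ct_eq_zero_of_d3 hc)
    · exact cst_eq_zero_of_ct (ct_eq_zero_of_d4 hc)
    · omega

theorem not_isKoszulAlgebra : ¬ IsKoszulAlgebra (gr k) := by
  by_cases h2 : (2 : k) = 0
  · exact (isLinearStrand_strand (m := 4) (by norm_num) (by norm_num)).not_isKoszulAlgebra rfl
      (hasMinimalQuadraticSyzygy_d3 h2)
  · exact (isLinearStrand_strand (m := 5) le_rfl fun _ => h2).not_isKoszulAlgebra rfl
      (hasMinimalQuadraticSyzygy_d4 h2)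

theorem ringChar_eq_two_iff : ringChar k = 2 ↔ (2 : k) = 0 := by
  constructor
  · intro h
    have := (ringChar.spec k 2).2 h.dvd
    exact_mod_cast this
  · intro h
    have h' := (ringChar.spec k 2).1 (by exact_mod_cast h)
    exact ((Nat.dvd_prime Nat.prime_two).1 h').resolve_left CharP.ringChar_ne_one

end BadAlgebra


theorem theoremA5 (k : Type*) [Field k] :
    -- the algebra retract `R → R'` with kernel `U = (a, b)`
    (∃ (φ : BadAlgebra.R k →ₐ[k] BadAlgebra.R' k) (σ : BadAlgebra.R' k →ₐ[k] BadAlgebra.R k),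
      φ (BadAlgebra.x k) = BadAlgebra.x' k ∧ φ (BadAlgebra.y k) = BadAlgebra.y' k ∧
      φ (BadAlgebra.a k) = 0 ∧ φ (BadAlgebra.b k) = 0 ∧
      σ (BadAlgebra.x' k) = BadAlgebra.x k ∧ σ (BadAlgebra.y' k) = BadAlgebra.y k ∧
      φ.comp σ = AlgHom.id k (BadAlgebra.R' k) ∧
      RingHom.ker φ = Ideal.span {BadAlgebra.a k, BadAlgebra.b k}) ∧
    -- `a` and `b` are minimal generators of `U`, of degree one
    (BadAlgebra.a k ∈ BadAlgebra.gr k 1 ∧ BadAlgebra.b k ∈ BadAlgebra.gr k 1 ∧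
      IsMinimalCover (BadAlgebra.gr k) (BadAlgebra.aug k)
        (Ideal.span {BadAlgebra.a k, BadAlgebra.b k})) ∧
    -- the first three steps of the minimal free resolution of `U`
    IsMinimalLinearCover (BadAlgebra.gr k) (BadAlgebra.d1 k)
      (LinearMap.ker (BadAlgebra.aug k)) ∧
    IsMinimalLinearCover (BadAlgebra.gr k) (BadAlgebra.d2 k)
      (LinearMap.ker (BadAlgebra.d1 k).mulVecLin) ∧
    IsMinimalLinearCover (BadAlgebra.gr k) (BadAlgebra.d3 k)
      (LinearMap.ker (BadAlgebra.d2 k).mulVecLin) ∧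
    -- characteristic two
    (ringChar k = 2 → HasMinimalQuadraticSyzygy (BadAlgebra.gr k) (BadAlgebra.d3 k)) ∧
    -- every other characteristic
    (ringChar k ≠ 2 →
      IsMinimalLinearCover (BadAlgebra.gr k) (BadAlgebra.d4 k)
        (LinearMap.ker (BadAlgebra.d3 k).mulVecLin) ∧
      HasMinimalQuadraticSyzygy (BadAlgebra.gr k) (BadAlgebra.d4 k)) ∧
    ¬ IsKoszulAlgebra (BadAlgebra.gr k) := by
  refine ⟨BadAlgebra.exists_retract, ⟨BadAlgebra.a_mem, BadAlgebra.b_mem, BadAlgebra.cover_aug⟩,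
    BadAlgebra.cover_d1, BadAlgebra.cover_d2, BadAlgebra.cover_d3, fun h => ?_, fun h => ?_,
    BadAlgebra.not_isKoszulAlgebra⟩
  · exact BadAlgebra.hasMinimalQuadraticSyzygy_d3 (BadAlgebra.ringChar_eq_two_iff.1 h)
  · have h2 : (2 : k) ≠ 0 := fun h0 => h (BadAlgebra.ringChar_eq_two_iff.2 h0)
    exact ⟨BadAlgebra.cover_d4 h2, BadAlgebra.hasMinimalQuadraticSyzygy_d4 h2⟩
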